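/- **Setting.** Let $k$ be an algebraically closed field, $K$ an algebraic function field of transcendence degree $3$ over $k$, and $\nu$ a $k$-valuation of $K$ with value group $\Gamma\subseteq\mathbb{Q}$, valuation ring $(V,m_V)$ and residue field $V/m_V=k$. Let $(R,m_R)$ be a regular local ring with $k\subset R\subset K$, fraction field $K$ and regular parameters $x,y,z$ (so $\dim R=3$ and $m_R=(x,y,z)$), dominated by $\nu$, i.e. $R\subset V$ and $m_V\cap R=m_R$. **Conventions.** Monomials in the $P_j$ and $T_j$ are formal, i.e. exponent vectors. A monomial $M$ is *irreducible* with respect to a set $\mathcal X$ of monomials if no monomial obtained from $M$ by lowering exponents ($M$ included) is in $\mathcal X$. For a semigroup $\Phi$ generated by $\mu_1,\dots,\mu_n$, a tuple $(a_1,\dots,a_n,a)$ of nonnegative integers is *reduced* with respect to $(\Phi,\mu)$ if $\sum a_i\mu_i+a\mu\in\Phi$, but $\sum b_i\mu_i+b\mu\notin\Phi$ for all integers $0\le b_i\le a_i$, $0<b\le a$ with $\sum b_i+b<\sum a_i+a$. **Polynomials $P_i$.** Put $P_0=x$, $P_1=y$. Let $\beta_i=\nu(P_i)$, $G_i=\sum_{j\le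 i}\beta_j\mathbb Z$, $S_i=\sum_{j\le i}\beta_j\mathbb Z_{\ge0}$, $G=\bigcup_i G_i$, and for $i>0$ let $q_i=\min\{q>0\mid q\beta_i\in G_{i-1}\}$; let $\mathcal P_i=\{P_j^{q_j}\mid 0<j<i\}$ and $\mathcal P=\bigcup_i\mathcal P_i$. For $i>0$ let $P_{i+1}=P_i^{q_i}-\lambda_i\prod_{j<i}P_j^{n_{i,j}}$, where $\prod_{j<i}P_j^{n_{i,j}}$ is irreducible with respect to $\mathcal P_i$ and has value $q_i\beta_i$, and $\lambda_i\in k$ is the residue of $P_i^{q_i}/\prod_{j<i} P_j^{n_{i,j}}$. **Polynomials $T_i$.** Put $T_1=z$, $m_0=0$, $\delta_0=1$, $\mathcal T_1=\mathcal P$. For $i>0$ let $\gamma_i=\nu(T_i)$ if $T_i\ne0$ and $\gamma_i=0$ if $T_i=0$; let $H_i=\sum_{1\le j\le i}\gamma_j\mathbb Z$ and $U_i=\sum_{1\le j\le i}\gamma_j\mathbb Z_{\ge0}$ (both $\{0\}$ for $i=0$), $s_i=\min\{s>0\mid s\gamma_i\in H_{i-1}+G\}$ and $m_i=\max(m_{i-1},\min\{j\mid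 s_i\gamma_i\in H_{i-1}+G_j\})$. If $T_i\neq0$, let $\mathcal D_i$ be the set of tuples $\bar d=(a_0,\dots,a_{m_i},c_1,\dots,c_i)$ of nonnegative integers with $c_i>0$ that are reduced with respect to $(S_{m_i}+U_{i-1},\,s_i\gamma_i)$, with generators $\beta_0,\dots,\beta_{m_i},\gamma_1,\dots,\gamma_{i-1}$, and for which $\prod_{j\le m_i}P_j^{a_j}\prod_{1\le j<i}T_j^{c_j}$ is irreducible with respect to $\mathcal T_i$. Write $M_{\bar d}=T_i^{c_is_i}\prod_{j\le m_i} P_j^{a_j}\prod_{1\le j<i}T_j^{c_j}$, let $|\bar d|$ be its value $c_is_i\gamma_i+\sum_{j\le m_i} a_j\beta_j+\sum_{1\le j<i}c_j\gamma_j$, and set $\mathcal T_{i+1}=\mathcal T_i\cup\{M_{\bar d}\mid\bar d\in\mathcal D_i\}$. If $T_i=0$, put $\mathcal D_i=\emptyset$ and $\mathcal T_{i+1}=\mathcal T_i\cup\{T_i\}$. Let $\delta_i=\#\mathcal D_i$ for $i>0$ and enumerate $\mathcal D_i=\{\bar d_1,\dots,\bar d_{\delta_i}\}$ with $|\bar d_1|\le\dots\le|\bar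 d_{\delta_i}|$ (ties ordered arbitrarily). For $1\le t\le\delta_i$ and $\bar d=\bar d_t$ let $$T_{\delta_0+\dots+\delta_{i-1}+t}=T_{\bar d}=M_{\bar d}-\mu_{\bar d}N_{\bar d},\qquad N_{\bar d}=\prod_{j\le m_i}P_j^{n_{\bar d,j}}\prod_{1\le j<i}T_j^{l_{\bar d,j}},$$ where $N_{\bar d}$ is irreducible with respect to $\mathcal T_i$ and has value $|\bar d|$, and $\mu_{\bar d}\in k$ is the residue of $M_{\bar d}/N_{\bar d}$. (Should this produce only finitely many $T_i$, put $T_i=0$ for the remaining $i$.) **Redundancy.** $T_j$ is an *immediate successor* of $T_i$ if $j=\delta_0+\dots+\delta_{i-1}+t$ with $1\le t\le\delta_i$; *successor* is the transitive closure of this relation on indices. $T_i$ is *redundant* if $T_i=0$, or if $\nu(T_i)\in S_{m_i}+U_{i-1}$ (in which case its only immediate successor is $T_{\delta_0+\dots+\delta_i}$), $T_i$ has finitely many nonzero successors, and $T_{\delta_0+\dots+\delta_i}$ is redundant. Let $\mathcal R=\{i>0\mid T_i\text{ is redundant}\}$. **Generating sequences.** A family $\{Q_i\}$ in $R$ is a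 generating sequence of $\nu$ in $R$ if for every $\sigma\in\nu(R\setminus\{0\})$ the ideal $I_\sigma=\{f\in R\mid\nu(f)\ge\sigma\}$ is generated by the finite products $\prod_i Q_i^{b_i}$, $b_i\in\mathbb Z_{\ge0}$, with $\nu(\prod_i Q_i^{b_i})\ge\sigma$. **Proposition.** The construction of the sequence $\{P_i\}_{i\ge0}\cup\{T_i\}_{i>0}$ of jumping polynomials can be carried out, and for every sequence so constructed the sequence $\{P_i\}_{i\ge0}\cup\{T_i\}_{i>0,\;i\notin\mathcal R}$, obtained by removing all redundant $T_i$, is a generating sequence of $\nu$ in $R$. -/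

import Mathlib

/-! Jumping polynomials of a `ℚ`-valued valuation `v` of `K` dominating a local subring `R` of `K`,
their redundancy, and generating sequences of valuations. -/

noncomputable section

namespace JumpingPolynomials

/-- Formal variables: `Sum.inl j` stands for `P_j` and `Sum.inr j` stands for `T_j`. -/
abbrev Var : Type := ℕ ⊕ ℕ

/-- Formal monomials in the variables `P_0, P_1, …, T_1, T_2, …`, as exponent vectors; the order
`M ≤ N` is the coordinatewise order of the exponents. -/
abbrev Mon : Type := Var →₀ ℕ

/-- The monomial `M` is irreducible with respect to the set `X` of monomials: no monomial
obtained by lowering exponents of `M` (including `M` itself) lies in `X`. -/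
def IsIrred (X : Set Mon) (M : Mon) : Prop := ∀ N ≤ M, N ∉ X

/-- The value `∑ a_j w_j` of an exponent vector `a` when the variable `j` has value `w_j`. -/
def weight {ι : Type*} (w : ι → ℚ) (a : ι →₀ ℕ) : ℚ := a.sum fun j n => (n : ℚ) * w j

/-- `(a, c)` is reduced with respect to `(Φ, {w_j}, μ)`: the number `∑ a_j w_j + c μ` lies in `Φ`,
and `∑ b_j w_j + e μ ∉ Φ` for all `0 ≤ b ≤ a`, `0 < e ≤ c` of smaller total exponent. -/
def IsReduced {ι : Type*} (Φ : AddSubmonoid ℚ) (w : ι → ℚ) (μ : ℚ) (a : ι →₀ ℕ) (c : ℕ) : Prop :=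
  weight w a + (c : ℚ) * μ ∈ Φ ∧
    ∀ (b : ι →₀ ℕ) (e : ℕ), b ≤ a → 0 < e → e ≤ c → b.degree + e < a.degree + c →
      weight w b + (e : ℚ) * μ ∉ Φ

section Construction

variable {R K : Type*} [CommRing R] [Field K] [Algebra R K] (v : AddValuation K (WithTop ℚ))

/-- The value of `f` as a rational number, with the convention that the value of `0` is `0`. -/
def val (f : R) : ℚ := (v (algebraMap R K f)).untopD 0

/-- `G_i = ∑_{j ≤ i} β_j ℤ`. -/
def G (P : ℕ → R) (i : ℕ) : AddSubgroup ℚ :=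
  AddSubgroup.closure ((fun j => val v (P j)) '' Set.Iic i)

/-- `G = ⋃ G_i`, the group generated by all the `β_j`. -/
def GInf (P : ℕ → R) : AddSubgroup ℚ :=
  AddSubgroup.closure (Set.range fun j => val v (P j))

/-- `S_i = ∑_{j ≤ i} β_j ℤ_{≥ 0}`. -/
def S (P : ℕ → R) (i : ℕ) : AddSubmonoid ℚ :=
  AddSubmonoid.closure ((fun j => val v (P j)) '' Set.Iic i)

/-- `q_i = min {q > 0 | q β_i ∈ G_{i-1}}`, for `i > 0`. -/
def q (P : ℕ → R) (i : ℕ) : ℕ := sInf {n : ℕ | 0 < n ∧ (n : ℚ) * val v (P i) ∈ G v P (i - 1)}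

/-- The set `𝒫_i = {P_j ^ q_j | 0 < j < i}` of formal monomials (so `𝒫_0 = 𝒫_1 = ∅` and
`𝒫_{i+1} = 𝒫_i ∪ {P_i ^ q_i}`). -/
def calP (P : ℕ → R) (i : ℕ) : Set Mon :=
  {M | ∃ j, 0 < j ∧ j < i ∧ M = Finsupp.single (Sum.inl j) (q v P j)}

/-- `𝒫 = ⋃ 𝒫_i`. -/
def calPInf (P : ℕ → R) : Set Mon := ⋃ i, calP v P i

/-- `H_i = ∑_{1 ≤ j ≤ i} γ_j ℤ`, where `γ_j = 0` if `T_j = 0`. -/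
def H (T : ℕ → R) (i : ℕ) : AddSubgroup ℚ :=
  AddSubgroup.closure ((fun j => val v (T j)) '' Set.Icc 1 i)

/-- `U_i = ∑_{1 ≤ j ≤ i} γ_j ℤ_{≥ 0}`, where `γ_j = 0` if `T_j = 0`. -/
def U (T : ℕ → R) (i : ℕ) : AddSubmonoid ℚ :=
  AddSubmonoid.closure ((fun j => val v (T j)) '' Set.Icc 1 i)

/-- `s_i = min {s > 0 | s γ_i ∈ H_{i-1} + G}`, for `i > 0`; this is `1` if `T_i = 0`. -/
def s (P T : ℕ → R) (i : ℕ) : ℕ :=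
  sInf {n : ℕ | 0 < n ∧ (n : ℚ) * val v (T i) ∈ H v T (i - 1) ⊔ GInf v P}

/-- `m_0 = 0` and `m_i = max (m_{i-1}, min {j | s_i γ_i ∈ H_{i-1} + G_j})`; the second entry is `0`
if `T_i = 0`. -/
def m (P T : ℕ → R) : ℕ → ℕ
  | 0 => 0
  | i + 1 => max (m P T i)
      (sInf {j : ℕ | (s v P T (i + 1) : ℚ) * val v (T (i + 1)) ∈ H v T i ⊔ G v P j})

/-- The values of the variables: `P_j` has value `β_j` and `T_j` has value `γ_j`. -/
def varVal (P T : ℕ → R) : Var → ℚ := Sum.elim (fun j => val v (P j)) (fun j => val v (T j))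

/-- The element of `R` represented by a formal monomial. -/
def evalMon (P T : ℕ → R) (M : Mon) : R := M.prod fun x n => Sum.elim P T x ^ n

/-- The variables `P_0, …, P_k, T_1, …, T_{i-1}`. -/
def vars (k i : ℕ) : Set Var := {x | (∃ j ≤ k, x = Sum.inl j) ∨ ∃ j, 0 < j ∧ j < i ∧ x = Sum.inr j}

/-- The set `𝒟_i` (with `X` in the place of `𝒯_i`). The tuple `(a_0, …, a_{m_i}, c_1, …, c_i)` is
written as the pair of the exponent vector `(a_0, …, a_{m_i}, c_1, …, c_{i-1})` and `c_i`. -/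
def DSet (P T : ℕ → R) (X : Set Mon) (i : ℕ) : Set (Mon × ℕ) :=
  {d | T i ≠ 0 ∧ ↑d.1.support ⊆ vars (m v P T i) i ∧ 0 < d.2 ∧
    IsReduced (S v P (m v P T i) ⊔ U v T (i - 1)) (varVal v P T)
      ((s v P T i : ℚ) * val v (T i)) d.1 d.2 ∧
    IsIrred X d.1}

/-- The formal monomial `T_i ^ (c_i s_i) ∏ P_j ^ a_j ∏_{j < i} T_j ^ c_j` of a tuple `d`. -/
def leadMon (P T : ℕ → R) (i : ℕ) (d : Mon × ℕ) : Mon :=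
  d.1 + Finsupp.single (Sum.inr i) (d.2 * s v P T i)

open Classical in
/-- The sets `𝒯_i`: `𝒯_1 = 𝒫`, and `𝒯_{i+1}` is obtained from `𝒯_i` by adding the monomials of the
elements of `𝒟_i` if `T_i ≠ 0`, and by adding the variable `T_i` if `T_i = 0`. (The index `0` is
not used.) -/
def calT (P T : ℕ → R) : ℕ → Set Mon
  | 0 => calPInf v P
  | 1 => calPInf v P
  | i + 2 => calT P T (i + 1) ∪
      if T (i + 1) = 0 then {Finsupp.single (Sum.inr (i + 1)) 1}
      else leadMon v P T (i + 1) '' DSet v P T (calT P T (i + 1)) (i + 1)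

/-- `𝒟_i`, for `i > 0`. It is empty if `T_i = 0`. -/
def D (P T : ℕ → R) (i : ℕ) : Set (Mon × ℕ) := DSet v P T (calT v P T i) i

/-- `δ_0 = 1` and `δ_i = #𝒟_i` for `i > 0`. -/
def δ (P T : ℕ → R) (i : ℕ) : ℕ := if i = 0 then 1 else (D v P T i).ncard

/-- `∑_{j < i} δ_j`. -/
def offset (P T : ℕ → R) (i : ℕ) : ℕ := ∑ j ∈ Finset.range i, δ v P T j

/-- The value `|d|` of the monomial of a tuple `d ∈ 𝒟_i`. -/
def absVal (P T : ℕ → R) (i : ℕ) (d : Mon × ℕ) : ℚ := weight (varVal v P T) (leadMon v P T i d)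

/-- `c` is the residue of `f / g` in `V / m_V = k`. -/
def IsResidue {k : Type*} [Field k] [Algebra k K] (f g : R) (c : k) : Prop :=
  0 < v (algebraMap R K f / algebraMap R K g - algebraMap k K c)

/-- `P_{i+1} = P_i ^ q_i - λ_i ∏_{j < i} P_j ^ n_{i,j}`, where the product is the irreducible
monomial of value `q_i β_i` and `λ_i` is the residue of the quotient. -/
def PStep (k : Type*) [Field k] [Algebra k K] [Algebra k R] (P T : ℕ → R) (i : ℕ) : Prop :=
  ∃ (N : Mon) (c : k),
    (∀ x ∈ N.support, ∃ j < i, x = Sum.inl j) ∧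
    (q v P i : ℚ) * val v (P i) = weight (varVal v P T) N ∧
    IsIrred (calP v P i) N ∧
    IsResidue v (P i ^ q v P i) (evalMon P T N) c ∧
    P (i + 1) = P i ^ q v P i - algebraMap k R c * evalMon P T N

/-- `f = T_d` for `d ∈ 𝒟_i`: `f = T_i ^ (c_i s_i) ∏ P_j ^ a_j ∏ T_j ^ c_j - μ_d ∏ P_j ^ n_{d,j}
∏_{j < i} T_j ^ l_{d,j}`, where the second product is the irreducible monomial of value `|d|`
and `μ_d` is the residue of the quotient. -/
def IsTd (k : Type*) [Field k] [Algebra k K] [Algebra k R] (P T : ℕ → R) (i : ℕ) (d : Mon × ℕ)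
    (f : R) : Prop :=
  ∃ (N : Mon) (c : k),
    ↑N.support ⊆ vars (m v P T i) i ∧
    absVal v P T i d = weight (varVal v P T) N ∧
    IsIrred (calT v P T i) N ∧
    IsResidue v (evalMon P T (leadMon v P T i d)) (evalMon P T N) c ∧
    f = evalMon P T (leadMon v P T i d) - algebraMap k R c * evalMon P T N

/-- `P_0, P_1, …` and `T_1, T_2, …` are jumping polynomials of `v` with respect to the regular
parameters `x, y, z`, for some admissible choice of the orderings of the sets `𝒟_i`.
The value `T 0` is irrelevant. Should the construction stop, that is, provide only finitely
many `T_i`, then the sequence is continued by zeros (`T_eq_zero`). -/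
structure IsJumpingSequence (k : Type*) [Field k] [Algebra k K] [Algebra k R] (x y z : R)
    (P T : ℕ → R) : Prop where
  P_zero : P 0 = x
  P_one : P 1 = y
  P_succ : ∀ i, 0 < i → PStep v k P T i
  T_one : T 1 = z
  T_succ : ∀ i, 0 < i → ∃ e : Fin (δ v P T i) ≃ D v P T i,
    (Monotone fun t => absVal v P T i (e t)) ∧
    ∀ t : Fin (δ v P T i), IsTd v k P T i (e t) (T (offset v P T i + (t + 1)))
  T_eq_zero : ∀ i, offset v P T i < i → T i = 0

/-- `T_j` is an immediate successor of `T_i`. -/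
def IsImmediateSuccessor (P T : ℕ → R) (i j : ℕ) : Prop :=
  0 < i ∧ ∃ t < δ v P T i, j = offset v P T i + (t + 1)

/-- `T_j` is a successor of `T_i`. -/
def IsSuccessor (P T : ℕ → R) : ℕ → ℕ → Prop := Relation.TransGen (IsImmediateSuccessor v P T)

/-- `T_i` is redundant: either `T_i = 0`, or `γ_i ∈ S_{m_i} + U_{i-1}` (in this case `T_i` has
exactly one immediate successor, the one of index `∑_{j ≤ i} δ_j`), `T_i` has finitely many nonzero
successors, and its immediate successor is redundant. -/
inductive IsRedundant (P T : ℕ → R) : ℕ → Prop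
  | of_eq_zero (i : ℕ) (hi : 0 < i) (h : T i = 0) : IsRedundant P T i
  | of_successor (i : ℕ) (hi : 0 < i)
      (hdep : val v (T i) ∈ S v P (m v P T i) ⊔ U v T (i - 1))
      (hfin : {j | IsSuccessor v P T i j ∧ T j ≠ 0}.Finite)
      (hsucc : IsRedundant P T (offset v P T (i + 1))) : IsRedundant P T i

/-- The index set of the sequence `{P_i}_{i ≥ 0} ∪ {T_i}_{i > 0, i ∉ 𝓡}`. -/
abbrev ReducedIndex (P T : ℕ → R) : Type := ℕ ⊕ {i : ℕ // 0 < i ∧ ¬ IsRedundant v P T i}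

/-- The sequence `{P_i}_{i ≥ 0} ∪ {T_i}_{i > 0, i ∉ 𝓡}`. -/
def reducedSequence (P T : ℕ → R) : ReducedIndex v P T → R := Sum.elim P fun i => T i.1

/-- The (finite or infinite) family `Q` is a generating sequence of `v` in `R`: for every value
`σ ∈ Φ_R = v (R \ {0})`, the ideal `I_σ = {f ∈ R | v f ≥ σ}` (its elements are listed on the left)
is generated by the products of powers of members of `Q` that have value at least `σ`. -/
def IsGeneratingSequence {ι : Type*} (Q : ι → R) : Prop :=
  ∀ σ : ℚ, (∃ g : R, v (algebraMap R K g) = (σ : WithTop ℚ)) →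
    {f : R | (σ : WithTop ℚ) ≤ v (algebraMap R K f)} =
      (Ideal.span {f : R | ∃ b : ι →₀ ℕ, f = b.prod (fun i n => Q i ^ n) ∧
        (σ : WithTop ℚ) ≤ v (algebraMap R K f)} : Set R)

end Construction

end JumpingPolynomials

end

/-!
The monomials in the `P_j` and `T_j` are compared by a colexicographic order (`MonLT`), in which
`P_0 < P_1 < ⋯ < T_1 < T_2 < ⋯`. Two facts about the union `𝒯` of the sets `𝒯_i`
carry the proof.

* An element `L` of `𝒯` can be rewritten (`exists_rewrite`): the definition of the jumping
  polynomials says that `L` is a jumping polynomial of larger value plus a constant multiple of a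
  smaller monomial of the same value. (A variable that is zero is itself in `𝒯`.)
* Monomials that are irreducible with respect to `𝒯` have pairwise distinct values
  (`eq_of_weight_eq`). In a coincidence of two values consider the last `T_i` in which the monomials
  differ. The difference of the exponents of `T_i` is a multiple of `s_i`. Because
  `H_i ∩ G ⊆ G_{m_i}` (`mem_G_m_of_mem_H`), the monomials agree in the `P_j` with `j > m_i`, so the
  monomial with the larger exponent lies above the monomial of a reduced tuple, which belongs to
  `𝒟_i` (`exponent_le_of_weight_eq`).

The ring `R` is spanned over `k` by monomials modulo any power of the maximal ideal, and a high power
of the maximal ideal is generated by monomials of large value. Rewriting terminates, since there are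
no infinite increasing sequences of values below a bound (`wellFounded_val_lt`) and the order of the
monomials is well-founded. Hence `f ∈ I_σ` is a linear combination of irreducible monomials of
value less than `σ`, up to an element of the ideal generated by monomials of value at least `σ`. The
combination is zero, since otherwise it would have the value of one of its monomials, so
the family of all jumping polynomials generates (`valIdeal_le_monIdeal`).

If `T_i` is redundant, then `T_i` itself is in `𝒯_{i+1}`, so irreducible monomials never contain
it, and following the chain of successors expresses `T_i` through irreducible monomials of at least
its value (`IsRedundant.mem_nonredundantSpan`). Hence the redundant `T_i` can be removed.

The sequences exist because `𝒟_i` is finite by Dickson's lemma (`finite_D`), because the smallest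
monomial with a given value in `S_{m_i} + U_{i-1}` is irreducible (`exists_irred_of_mem`), and
because `q_i β_i ∈ G_{i-1}` has a normal form, whose coefficient of `β_0` is nonnegative since
`q_j β_j ≤ β_{j+1}` (`exists_normal_form`). Regularity of `R` enters only through `x ≠ 0`; that some
`P_i` might vanish does no harm, as `q_i = 1` makes such a `P_i` a reducible variable.
-/

namespace JumpingPolynomials

/-! ### Weights and multiples -/

section Weight

variable {ι : Type*} {w : ι → ℚ}

/-- The value of a vector of integer exponents, when the variable `j` has value `w j`. -/
noncomputable abbrev zweight (w : ι → ℚ) : (ι →₀ ℤ) →ₗ[ℤ] ℚ := Finsupp.linearCombination ℤ w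

/-- A vector of natural exponents, seen as a vector of integer exponents. -/
noncomputable abbrev toInt : (ι →₀ ℕ) →+ (ι →₀ ℤ) :=
  Finsupp.mapRange.addMonoidHom (Nat.castAddMonoidHom ℤ)

lemma weight_eq_linearCombination (a : ι →₀ ℕ) : weight w a = Finsupp.linearCombination ℕ w a := by
  simp [weight, Finsupp.linearCombination_apply]

@[simp] lemma weight_zero : weight w 0 = 0 := by simp [weight]

@[simp] lemma weight_add (a b : ι →₀ ℕ) : weight w (a + b) = weight w a + weight w b := by
  simp [weight_eq_linearCombination]

@[simp] lemma weight_single (x : ι) (n : ℕ) : weight w (Finsupp.single x n) = n * w x := by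
  simp [weight]

lemma weight_congr {w' : ι → ℚ} {a : ι →₀ ℕ} (h : ∀ x ∈ a.support, w x = w' x) :
    weight w a = weight w' a :=
  Finsupp.sum_congr fun x hx => by rw [h x hx]

lemma weight_mem {A : AddSubmonoid ℚ} {a : ι →₀ ℕ} (h : ∀ x ∈ a.support, w x ∈ A) :
    weight w a ∈ A :=
  sum_mem fun x hx => by
    simpa only [nsmul_eq_mul] using nsmul_mem (h x hx) (a x)

lemma zweight_toInt (a : ι →₀ ℕ) : zweight w (toInt a) = weight w a := by
  induction a using Finsupp.induction_linear with
  | zero => simp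
  | add f g hf hg => simp only [map_add, weight_add, hf, hg]
  | single x n => simp

lemma zweight_mem {A : AddSubgroup ℚ} {u : ι →₀ ℤ} (h : ∀ x ∈ u.support, w x ∈ A) :
    zweight w u ∈ A := by
  rw [zweight, Finsupp.linearCombination_apply]
  exact sum_mem fun x hx => zsmul_mem (h x hx) _

lemma zweight_eq_add_erase [DecidableEq ι] (u : ι →₀ ℤ) (x : ι) :
    zweight w u = u x * w x + zweight w (u.erase x) := by
  conv_lhs => rw [← Finsupp.single_add_erase x u]
  simp

lemma exists_weight_of_mem_closure {B : Set ι} {g : ℚ} (hg : g ∈ AddSubmonoid.closure (w '' B)) :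
    ∃ a : ι →₀ ℕ, ↑a.support ⊆ B ∧ weight w a = g := by
  induction hg using AddSubmonoid.closure_induction with
  | mem g hg =>
    obtain ⟨x, hx, rfl⟩ := hg
    refine ⟨Finsupp.single x 1, fun y hy => ?_, by simp⟩
    have := Finsupp.support_single_subset hy
    rw [Finset.mem_singleton] at this
    exact this ▸ hx
  | zero => exact ⟨0, by simp, by simp⟩
  | add g h _ _ hg hh =>
    classical
    obtain ⟨a, ha, rfl⟩ := hg
    obtain ⟨b, hb, rfl⟩ := hh
    refine ⟨a + b, fun x hx => ?_, by simp⟩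
    rcases Finset.mem_union.1 (Finsupp.support_add hx) with h | h
    exacts [ha h, hb h]

end Weight

section LeastMultiple

/-- The least positive `n` such that `n g` lies in the subgroup `A` of `ℚ`. -/
noncomputable def leastMultiple (A : AddSubgroup ℚ) (g : ℚ) : ℕ :=
  sInf {n : ℕ | 0 < n ∧ (n : ℚ) * g ∈ A}

variable {A : AddSubgroup ℚ} {b : ℚ} (hb : b ∈ A) (hb0 : b ≠ 0) (g : ℚ)
include hb hb0

lemma exists_nat_mul_mem : ∃ n : ℕ, 0 < n ∧ (n : ℚ) * g ∈ A := by
  have hn : 0 < g.den * b.num.natAbs :=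
    Nat.mul_pos g.pos (Int.natAbs_pos.2 (Rat.num_ne_zero.2 hb0))
  refine ⟨_, hn, ?_⟩
  have key : ((g.den * b.num.natAbs : ℕ) : ℚ) * g = ((b.num.sign * g.num * b.den : ℤ) : ℚ) * b := by
    have h1 : (g.den : ℚ) * g = g.num := Rat.den_mul_eq_num g
    have h2 : (b.den : ℚ) * b = b.num := Rat.den_mul_eq_num b
    have h3 : ((b.num.natAbs : ℕ) : ℚ) = (b.num.sign : ℚ) * b.num := by
      rw [← Int.cast_natCast, ← Int.sign_mul_self_eq_natAbs, Int.cast_mul]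
    push_cast
    rw [h3]
    linear_combination (b.num.sign * b.num : ℚ) * h1 - (b.num.sign * g.num : ℚ) * h2
  rw [key, ← zsmul_eq_mul]
  exact zsmul_mem hb _

lemma leastMultiple_pos : 0 < leastMultiple A g := (Nat.sInf_mem (exists_nat_mul_mem hb hb0 g)).1

lemma leastMultiple_mul_mem : (leastMultiple A g : ℚ) * g ∈ A :=
  (Nat.sInf_mem (exists_nat_mul_mem hb hb0 g)).2

lemma leastMultiple_dvd {z : ℤ} (hz : (z : ℚ) * g ∈ A) : (leastMultiple A g : ℤ) ∣ z := by
  have hpos := leastMultiple_pos hb hb0 g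
  have hmem := leastMultiple_mul_mem hb hb0 g
  rw [Int.dvd_iff_emod_eq_zero]
  by_contra hne
  have h0 : 0 ≤ z % leastMultiple A g := Int.emod_nonneg _ (by positivity)
  have hlt : z % leastMultiple A g < leastMultiple A g := Int.emod_lt_of_pos _ (by positivity)
  have hr : ((z % leastMultiple A g : ℤ) : ℚ) * g ∈ A := by
    have : ((z % leastMultiple A g : ℤ) : ℚ) * g =
        (z : ℚ) * g - (z / leastMultiple A g : ℤ) • ((leastMultiple A g : ℚ) * g) := by
      rw [Int.emod_def]
      push_cast
      rw [zsmul_eq_mul]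
      ring
    rw [this]
    exact sub_mem hz (zsmul_mem hmem _)
  have := Nat.sInf_le (s := {n : ℕ | 0 < n ∧ (n : ℚ) * g ∈ A})
    (m := (z % leastMultiple A g).toNat) ⟨by omega, by
      have h : (((z % leastMultiple A g).toNat : ℤ) : ℚ) = ((z % leastMultiple A g : ℤ) : ℚ) := by
        rw [Int.toNat_of_nonneg h0]
      rw [Int.cast_natCast] at h
      rwa [h]⟩
  change leastMultiple A g ≤ _ at this
  omega

end LeastMultiple

lemma leastMultiple_eq_one {A : AddSubgroup ℚ} {g : ℚ} (hg : g ∈ A) : leastMultiple A g = 1 := by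
  have h1 : (1 : ℕ) ∈ {n : ℕ | 0 < n ∧ (n : ℚ) * g ∈ A} := ⟨one_pos, by simpa using hg⟩
  exact le_antisymm (Nat.sInf_le h1) (Nat.sInf_mem ⟨1, h1⟩).1

/-! ### The order of the monomials -/

/-- The comparison of two monomials at the largest variable in which they differ, where
`P_0 < P_1 < ⋯ < T_1 < T_2 < ⋯`. -/
def MonLT : Mon → Mon → Prop := Finsupp.Lex (fun x y => Sum.Lex (· < ·) (· < ·) y x) (· < ·)

lemma wellFounded_monLT : WellFounded MonLT :=
  haveI : Std.Trichotomous (fun x y : Var => Sum.Lex (· < ·) (· < ·) y x) :=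
    ⟨fun x y h₁ h₂ => (@Std.Trichotomous.trichotomous _ (Sum.Lex (α := ℕ) (β := ℕ) (· < ·) (· < ·))
      inferInstance x y h₂ h₁)⟩
  Finsupp.Lex.wellFounded' (fun _ => Nat.not_lt_zero _) wellFounded_lt
    (Sum.lex_wf wellFounded_lt wellFounded_lt)

lemma MonLT.add_right {M N : Mon} (h : MonLT M N) (L : Mon) : MonLT (M + L) (N + L) := by
  obtain ⟨x, hx, hlt⟩ := h
  exact ⟨x, fun y hy => by simp [hx y hy], by simpa using hlt⟩

/-- `N < L` if `N` involves only variables that are smaller than some variable of `L`. -/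
lemma monLT_of_forall_lt {M N : Mon} {x : Var} (hx : 0 < M x)
    (hN : ∀ y ∈ N.support, Sum.Lex (· < ·) (· < ·) y x)
    (hL : ∀ y, Sum.Lex (· < ·) (· < ·) x y → M y = 0) :
    MonLT N M := by
  have hirr : ∀ y ∈ N.support, ¬ Sum.Lex (· < ·) (· < ·) x y := fun y hy h =>
    by rcases hN y hy with h' | h' | _ <;> cases h <;> exact lt_asymm ‹_› ‹_›
  have h0 : ∀ y, ¬ Sum.Lex (· < ·) (· < ·) y x → N y = 0 := fun y hy => by
    by_contra h
    exact hy (hN y (Finsupp.mem_support_iff.2 h))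
  refine ⟨x, fun y hy => ?_, ?_⟩
  · rw [hL y hy]
    by_contra h
    exact hirr y (Finsupp.mem_support_iff.2 h) hy
  · rwa [h0 x (fun h => by rcases h with h | h | _ <;> exact lt_irrefl _ ‹_›)]

/-- `k` is the residue field of `v`, and `v` is trivial on `k` and nonnegative on `R ⊆ K`. -/
structure IsRational (k R : Type*) {K : Type*} [Field k] [CommRing R] [Field K] [Algebra k K]
    [Algebra R K] (v : AddValuation K (WithTop ℚ)) : Prop where
  injective : Function.Injective (algebraMap R K)
  map_const : ∀ c : k, c ≠ 0 → v (algebraMap k K c) = 0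
  exists_residue : ∀ f : K, 0 ≤ v f → ∃ c : k, 0 < v (f - algebraMap k K c)
  nonneg : ∀ f : R, 0 ≤ v (algebraMap R K f)

section Valuation

variable {k R K : Type*} [Field k] [CommRing R] [Field K] [Algebra k K] [Algebra R K]
  {v : AddValuation K (WithTop ℚ)} {P T : ℕ → R}

@[simp] lemma val_zero : val v (0 : R) = 0 := by simp [val]

lemma coe_val (hv : IsRational k R v) {f : R} (hf : f ≠ 0) :
    v (algebraMap R K f) = (val v f : ℚ) := by
  have : v (algebraMap R K f) ≠ ⊤ := by
    rw [AddValuation.ne_top_iff]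
    exact (map_ne_zero_iff _ hv.injective).2 hf
  obtain ⟨a, ha⟩ := WithTop.ne_top_iff_exists.1 this
  simp [val, ← ha]

lemma val_nonneg (hv : IsRational k R v) (f : R) : 0 ≤ val v f := by
  by_cases hf : f = 0
  · simp [hf]
  · have := hv.nonneg f
    rw [coe_val hv hf] at this
    exact_mod_cast this

lemma isDomain_of_isRational (hv : IsRational k R v) : IsDomain R :=
  hv.injective.isDomain (algebraMap R K)

lemma exists_isResidue (hv : IsRational k R v) {f g : R} (hg : g ≠ 0)
    (h : v (algebraMap R K f) = v (algebraMap R K g)) : ∃ c : k, IsResidue v f g c := by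
  refine hv.exists_residue _ (le_of_eq ?_)
  rw [AddValuation.map_div, h, coe_val hv hg]
  exact_mod_cast (sub_self _).symm

lemma lt_sub_of_isResidue [Algebra k R] [IsScalarTower k R K] (hv : IsRational k R v) {f g : R}
    (hg : g ≠ 0) {c : k} (hc : IsResidue v f g c) :
    v (algebraMap R K g) < v (algebraMap R K (f - algebraMap k R c * g)) := by
  have hg' : algebraMap R K g ≠ 0 := (map_ne_zero_iff _ hv.injective).2 hg
  have : algebraMap R K (f - algebraMap k R c * g) =
      algebraMap R K g * (algebraMap R K f / algebraMap R K g - algebraMap k K c) := by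
    rw [map_sub, map_mul, ← IsScalarTower.algebraMap_apply k R K]
    field_simp
  rw [this, AddValuation.map_mul, coe_val hv hg]
  unfold IsResidue at hc
  revert hc
  cases v (algebraMap R K f / algebraMap R K g - algebraMap k K c) with
  | top => simp
  | coe a =>
    intro hc
    norm_cast at hc ⊢
    linarith

@[simp] lemma evalMon_zero : evalMon P T 0 = 1 := by simp [evalMon]

@[simp] lemma evalMon_add (M N : Mon) : evalMon P T (M + N) = evalMon P T M * evalMon P T N :=
  Finsupp.prod_add_index' (by simp) (by simp [pow_add])

@[simp] lemma evalMon_single (x : Var) (n : ℕ) :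
    evalMon P T (Finsupp.single x n) = Sum.elim P T x ^ n := by
  simp [evalMon]

lemma evalMon_congr {P' T' : ℕ → R} {M : Mon}
    (h : ∀ x ∈ M.support, Sum.elim P T x = Sum.elim P' T' x) : evalMon P T M = evalMon P' T' M :=
  Finsupp.prod_congr fun x hx => by rw [h x hx]

lemma varVal_apply (x : Var) : varVal v P T x = val v (Sum.elim P T x) := by
  cases x <;> rfl

@[simp] lemma varVal_inl (j : ℕ) : varVal v P T (Sum.inl j) = val v (P j) := rfl

@[simp] lemma varVal_inr (j : ℕ) : varVal v P T (Sum.inr j) = val v (T j) := rfl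

lemma evalMon_ne_zero (hv : IsRational k R v) {M : Mon}
    (h : ∀ x ∈ M.support, Sum.elim P T x ≠ 0) : evalMon P T M ≠ 0 :=
  have := isDomain_of_isRational hv
  Finset.prod_ne_zero_iff.2 fun x hx => pow_ne_zero _ (h x hx)

lemma elim_ne_zero_of_evalMon_ne_zero {M : Mon} (h : evalMon P T M ≠ 0) {x : Var}
    (hx : x ∈ M.support) : Sum.elim P T x ≠ 0 := fun h0 =>
  h (Finset.prod_eq_zero hx (by simp [h0, Finsupp.mem_support_iff.1 hx]))

lemma v_evalMon (hv : IsRational k R v) {M : Mon} (h : evalMon P T M ≠ 0) :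
    v (algebraMap R K (evalMon P T M)) = (weight (varVal v P T) M : ℚ) := by
  have h' : ∀ x ∈ M.support, Sum.elim P T x ≠ 0 := fun x => elim_ne_zero_of_evalMon_ne_zero h
  clear h
  induction M using Finsupp.induction with
  | zero => simp
  | single_add x n M hx hn ih =>
    have hs : (Finsupp.single x n + M).support = insert x M.support := by
      rw [Finsupp.support_add_eq, Finsupp.support_single x hn, Finset.insert_eq]
      rw [Finsupp.support_single x hn]
      simpa using hx
    rw [evalMon_add, map_mul, AddValuation.map_mul, ih fun y hy => h' y (by simp [hs, hy]),
      evalMon_single, map_pow, AddValuation.map_pow, coe_val hv (h' x (by simp [hs])), weight_add,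
      weight_single, varVal_apply, ← nsmul_eq_mul]
    push_cast
    rfl

end Valuation

/-! ### The groups `G_i`, `H_i` and the numbers `q_i`, `s_i`, `m_i` -/

section Groups

variable {R K : Type*} [CommRing R] [Field K] [Algebra R K]
  {v : AddValuation K (WithTop ℚ)} {P T : ℕ → R}

lemma val_mem_G {j i : ℕ} (h : j ≤ i) : val v (P j) ∈ G v P i :=
  AddSubgroup.subset_closure ⟨j, h, rfl⟩

lemma val_mem_GInf (j : ℕ) : val v (P j) ∈ GInf v P := AddSubgroup.subset_closure ⟨j, rfl⟩

lemma val_mem_H {j i : ℕ} (h0 : 0 < j) (h : j ≤ i) : val v (T j) ∈ H v T i :=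
  AddSubgroup.subset_closure ⟨j, ⟨h0, h⟩, rfl⟩

lemma val_mem_S {j i : ℕ} (h : j ≤ i) : val v (P j) ∈ S v P i :=
  AddSubmonoid.subset_closure ⟨j, h, rfl⟩

lemma val_mem_U {j i : ℕ} (h0 : 0 < j) (h : j ≤ i) : val v (T j) ∈ U v T i :=
  AddSubmonoid.subset_closure ⟨j, ⟨h0, h⟩, rfl⟩

lemma G_mono : Monotone (G v P) := fun _ _ h =>
  AddSubgroup.closure_mono (Set.image_mono (Set.Iic_subset_Iic.2 h))

lemma G_le_GInf (i : ℕ) : G v P i ≤ GInf v P :=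
  AddSubgroup.closure_mono (Set.image_subset_range _ _)

lemma exists_mem_G {g : ℚ} (hg : g ∈ GInf v P) : ∃ j, g ∈ G v P j := by
  induction hg using AddSubgroup.closure_induction with
  | mem g hg =>
    obtain ⟨j, rfl⟩ := hg
    exact ⟨j, val_mem_G le_rfl⟩
  | zero => exact ⟨0, zero_mem _⟩
  | add g h _ _ hg hh =>
    obtain ⟨a, ha⟩ := hg
    obtain ⟨b, hb⟩ := hh
    exact ⟨max a b, add_mem (G_mono (le_max_left a b) ha) (G_mono (le_max_right a b) hb)⟩
  | neg g _ hg =>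
    obtain ⟨a, ha⟩ := hg
    exact ⟨a, neg_mem ha⟩

lemma S_sup_U_le (a b : ℕ) :
    S v P a ⊔ U v T b ≤ (H v T b ⊔ GInf v P).toAddSubmonoid := by
  refine sup_le ?_ ?_
  · refine AddSubmonoid.closure_le.2 ?_
    rintro _ ⟨j, -, rfl⟩
    exact (le_sup_right : _ ≤ H v T b ⊔ GInf v P) (val_mem_GInf j)
  · refine AddSubmonoid.closure_le.2 ?_
    rintro _ ⟨j, hj, rfl⟩
    exact (le_sup_left : _ ≤ H v T b ⊔ GInf v P) (val_mem_H hj.1 hj.2)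

lemma q_eq (i : ℕ) : q v P i = leastMultiple (G v P (i - 1)) (val v (P i)) := rfl

lemma s_eq (i : ℕ) : s v P T i = leastMultiple (H v T (i - 1) ⊔ GInf v P) (val v (T i)) := rfl

lemma q_eq_one {j : ℕ} (h : P j = 0) : q v P j = 1 :=
  leastMultiple_eq_one (by simp [h])

lemma m_mono : Monotone (m v P T) := monotone_nat_of_le_succ fun _ => le_max_left _ _

variable (hβ : 0 < val v (P 0))
include hβ

lemma q_pos (i : ℕ) : 0 < q v P i :=
  leastMultiple_pos (val_mem_G (Nat.zero_le _)) hβ.ne' _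

lemma q_mul_mem (i : ℕ) : (q v P i : ℚ) * val v (P i) ∈ G v P (i - 1) :=
  leastMultiple_mul_mem (val_mem_G (Nat.zero_le _)) hβ.ne' _

lemma q_dvd {i : ℕ} {z : ℤ} (hz : (z : ℚ) * val v (P i) ∈ G v P (i - 1)) : (q v P i : ℤ) ∣ z :=
  leastMultiple_dvd (val_mem_G (Nat.zero_le _)) hβ.ne' _ hz

omit hβ in
lemma val_zero_mem_sup (i : ℕ) : val v (P 0) ∈ H v T i ⊔ GInf v P :=
  (le_sup_right : _ ≤ H v T i ⊔ GInf v P) (val_mem_GInf 0)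

lemma s_pos (i : ℕ) : 0 < s v P T i := leastMultiple_pos (val_zero_mem_sup _) hβ.ne' _

lemma s_dvd {i : ℕ} {z : ℤ} (hz : (z : ℚ) * val v (T i) ∈ H v T (i - 1) ⊔ GInf v P) :
    (s v P T i : ℤ) ∣ z :=
  leastMultiple_dvd (val_zero_mem_sup _) hβ.ne' _ hz

lemma s_mul_mem (i : ℕ) :
    (s v P T (i + 1) : ℚ) * val v (T (i + 1)) ∈ H v T i ⊔ G v P (m v P T (i + 1)) := by
  have h : (s v P T (i + 1) : ℚ) * val v (T (i + 1)) ∈ H v T i ⊔ GInf v P :=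
    leastMultiple_mul_mem (val_zero_mem_sup _) hβ.ne' _
  have hne : {j : ℕ | (s v P T (i + 1) : ℚ) * val v (T (i + 1)) ∈ H v T i ⊔ G v P j}.Nonempty := by
    obtain ⟨a, ha, b, hb, hab⟩ := AddSubgroup.mem_sup.1 h
    obtain ⟨j, hj⟩ := exists_mem_G hb
    exact ⟨j, AddSubgroup.mem_sup.2 ⟨a, ha, b, hj, hab⟩⟩
  exact sup_le_sup_left (G_mono (le_max_right _ _)) _ (Nat.sInf_mem hne)

/-- The relations among the values of the `T_j`, `j ≤ i`, modulo the group `G` of the values of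
the `P_j` involve only `P_0, …, P_{m_i}`. -/
lemma mem_G_m_of_mem_H (i : ℕ) {h : ℚ} (hH : h ∈ H v T i) (hG : h ∈ GInf v P) :
    h ∈ G v P (m v P T i) := by
  induction i generalizing h with
  | zero =>
    have : H v T 0 = ⊥ := by simp [H]
    rw [this, AddSubgroup.mem_bot] at hH
    exact hH ▸ zero_mem _
  | succ i ih =>
    have hsplit : H v T (i + 1) ≤ H v T i ⊔ AddSubgroup.zmultiples (val v (T (i + 1))) := by
      refine (AddSubgroup.closure_le _).2 ?_
      rintro _ ⟨j, hj, rfl⟩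
      rcases Nat.lt_or_ge j (i + 1) with h | h
      · exact (le_sup_left : H v T i ≤ _) (val_mem_H hj.1 (by omega))
      · obtain rfl : j = i + 1 := le_antisymm hj.2 h
        exact (le_sup_right : _ ≤ H v T i ⊔ AddSubgroup.zmultiples (val v (T (i + 1))))
          (AddSubgroup.mem_zmultiples _)
    obtain ⟨a, ha, b, hb, rfl⟩ := AddSubgroup.mem_sup.1 (hsplit hH)
    obtain ⟨z, rfl⟩ := AddSubgroup.mem_zmultiples_iff.1 hb
    rw [zsmul_eq_mul] at hG ⊢
    have hz : (z : ℚ) * val v (T (i + 1)) ∈ H v T i ⊔ GInf v P := by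
      rw [← add_sub_cancel_left a ((z : ℚ) * _), sub_eq_neg_add]
      exact AddSubgroup.mem_sup.2 ⟨_, neg_mem ha, _, hG, rfl⟩
    obtain ⟨y, rfl⟩ := s_dvd (i := i + 1) hβ hz
    obtain ⟨c, hc, g, hg, hcg⟩ := AddSubgroup.mem_sup.1 (s_mul_mem (T := T) hβ i)
    clear hsplit
    have hsplit' : a + ((s v P T (i + 1) * y : ℤ) : ℚ) * val v (T (i + 1)) =
        (a + y • c) + y • g := by
      push_cast
      simp only [zsmul_eq_mul]
      linear_combination (-(y : ℚ)) * hcg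
    rw [hsplit'] at hG ⊢
    refine add_mem (G_mono (m_mono i.le_succ) (ih (add_mem ha (zsmul_mem hc y)) ?_))
      (zsmul_mem hg y)
    exact (add_mem_cancel_right (G_le_GInf _ (zsmul_mem hg y))).1 hG

/-- In a relation modulo `G_k` among the `β_j` whose coefficients at `j > 0` are smaller than `q_j`,
the coefficients at `j > k` vanish. -/
lemma coeff_eq_zero_of_mem_G {u : Var →₀ ℤ} (hu : ∀ x ∈ u.support, ∃ j, x = Sum.inl j)
    (hq : ∀ j, 0 < j → |u (Sum.inl j)| < q v P j) {i : ℕ} (hi : zweight (varVal v P T) u ∈ G v P i)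
    {j : ℕ} (hj : i < j) : u (Sum.inl j) = 0 := by
  classical
  by_contra hne
  -- the largest index with a nonzero coefficient
  have hfin : (Sum.inl ⁻¹' (u.support : Set Var) : Set ℕ).Finite :=
    (Finset.finite_toSet _).preimage Sum.inl_injective.injOn
  obtain ⟨l, hl, hmax⟩ := Set.exists_max_image _ id hfin ⟨j, by simpa using hne⟩
  have hjl : j ≤ l := hmax j (by simpa using hne)
  have hrest : zweight (varVal v P T) (u.erase (Sum.inl l)) ∈ G v P (l - 1) := by
    refine zweight_mem fun x hx => ?_
    rw [Finsupp.support_erase, Finset.mem_erase] at hx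
    obtain ⟨a, rfl⟩ := hu x hx.2
    have h1 : a ≤ l := hmax a hx.2
    have h2 : a ≠ l := fun h => hx.1 (h ▸ rfl)
    exact val_mem_G (by omega)
  rw [zweight_eq_add_erase u (Sum.inl l)] at hi
  have hmem : (u (Sum.inl l) : ℚ) * val v (P l) ∈ G v P (l - 1) :=
    (add_mem_cancel_right hrest).1 (G_mono (by omega) hi)
  have := Int.eq_zero_of_abs_lt_dvd (q_dvd hβ hmem) (hq l (by omega))
  exact (Finsupp.mem_support_iff.1 hl) this

end Groups

/-! ### The sets `𝒯_i` -/

section Irreducible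

variable {R K : Type*} [CommRing R] [Field K] [Algebra R K]
  {v : AddValuation K (WithTop ℚ)} {P T : ℕ → R}

lemma IsIrred.anti {X Y : Set Mon} {M : Mon} (h : IsIrred Y M) (hXY : X ⊆ Y) : IsIrred X M :=
  fun N hN hX => h N hN (hXY hX)

lemma IsIrred.of_le {X : Set Mon} {M N : Mon} (h : IsIrred X M) (hN : N ≤ M) : IsIrred X N :=
  fun L hL => h L (hL.trans hN)

lemma mem_calPInf {L : Mon} :
    L ∈ calPInf v P ↔ ∃ j, 0 < j ∧ L = Finsupp.single (Sum.inl j) (q v P j) := by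
  refine ⟨fun h => ?_, ?_⟩
  · obtain ⟨i, j, hj, -, rfl⟩ := Set.mem_iUnion.1 h
    exact ⟨j, hj, rfl⟩
  · rintro ⟨j, hj, rfl⟩
    exact Set.mem_iUnion.2 ⟨j + 1, j, hj, j.lt_succ_self, rfl⟩

lemma mem_calT {i : ℕ} {L : Mon} : L ∈ calT v P T i ↔
    (∃ j, 0 < j ∧ L = Finsupp.single (Sum.inl j) (q v P j)) ∨
    (∃ l, 0 < l ∧ l < i ∧ T l = 0 ∧ L = Finsupp.single (Sum.inr l) 1) ∨
    ∃ l, 0 < l ∧ l < i ∧ ∃ d ∈ D v P T l, L = leadMon v P T l d := by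
  induction i with
  | zero => simp [calT, mem_calPInf]
  | succ i ih =>
    cases i with
    | zero =>
      have h : ∀ l, 0 < l → ¬ l < 0 + 1 := by omega
      rw [← mem_calPInf (v := v) (P := P)]
      refine ⟨Or.inl, ?_⟩
      rintro (h' | ⟨l, h0, h1, -⟩ | ⟨l, h0, h1, -⟩)
      exacts [h', absurd h1 (h l h0), absurd h1 (h l h0)]
    | succ i =>
      rw [calT, Set.mem_union, ih]
      constructor
      · rintro ((h | ⟨l, h0, h1, h⟩ | ⟨l, h0, h1, h⟩) | h)
        · exact Or.inl h
        · exact Or.inr (Or.inl ⟨l, h0, by omega, h⟩)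
        · exact Or.inr (Or.inr ⟨l, h0, by omega, h⟩)
        · split_ifs at h with hT
          · exact Or.inr (Or.inl ⟨i + 1, by omega, by omega, hT, h⟩)
          · obtain ⟨d, hd, rfl⟩ := h
            exact Or.inr (Or.inr ⟨i + 1, by omega, by omega, d, hd, rfl⟩)
      · rintro (h | ⟨l, h0, h1, hT, h⟩ | ⟨l, h0, h1, d, hd, h⟩)
        · exact Or.inl (Or.inl h)
        · rcases Nat.lt_or_ge l (i + 1) with hl | hl
          · exact Or.inl (Or.inr (Or.inl ⟨l, h0, hl, hT, h⟩))
          · obtain rfl : l = i + 1 := by omega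
            exact Or.inr (by simpa [hT] using h)
        · rcases Nat.lt_or_ge l (i + 1) with hl | hl
          · exact Or.inl (Or.inr (Or.inr ⟨l, h0, hl, d, hd, h⟩))
          · obtain rfl : l = i + 1 := by omega
            refine Or.inr ?_
            rw [if_neg hd.1]
            exact ⟨d, hd, h.symm⟩

lemma calT_mono : Monotone (calT v P T) := fun i i' h L hL => by
  rw [mem_calT] at hL ⊢
  rcases hL with h' | ⟨l, h0, h1, h'⟩ | ⟨l, h0, h1, h'⟩
  exacts [Or.inl h', Or.inr (Or.inl ⟨l, h0, by omega, h'⟩), Or.inr (Or.inr ⟨l, h0, by omega, h'⟩)]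

lemma IsIrred.P_ne_zero {i : ℕ} {M : Mon} (h0 : P 0 ≠ 0) (h : IsIrred (calP v P i) M) {j : ℕ}
    (hj : j < i) (hx : Sum.inl j ∈ M.support) : P j ≠ 0 := fun hP => by
  rcases Nat.eq_zero_or_pos j with rfl | hj0
  · exact h0 hP
  · refine h (Finsupp.single (Sum.inl j) (q v P j)) ?_ ⟨j, hj0, hj, rfl⟩
    rw [q_eq_one hP]
    exact Finsupp.single_le_iff.2 (Nat.one_le_iff_ne_zero.2 (Finsupp.mem_support_iff.1 hx))

lemma IsIrred.lt_q {i : ℕ} {M : Mon} (h : IsIrred (calT v P T i) M) {j : ℕ} (hj : 0 < j) :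
    M (Sum.inl j) < q v P j := by
  by_contra hlt
  exact h _ (Finsupp.single_le_iff.2 (not_lt.1 hlt)) (mem_calT.2 (Or.inl ⟨j, hj, rfl⟩))

lemma IsIrred.evalMon_ne_zero {k : Type*} [Field k] [Algebra k K] (hv : IsRational k R v)
    (h0 : P 0 ≠ 0) {i : ℕ} {M : Mon} (h : IsIrred (calT v P T i) M)
    (hM : ∀ j, Sum.inr j ∈ M.support → 0 < j ∧ j < i) : evalMon P T M ≠ 0 := by
  refine JumpingPolynomials.evalMon_ne_zero hv ?_
  rintro (j | j) hx
  · refine IsIrred.P_ne_zero (v := v) (i := j + 1) h0 (h.anti ?_) j.lt_succ_self hx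
    rintro _ ⟨l, hl, -, rfl⟩
    exact mem_calT.2 (Or.inl ⟨l, hl, rfl⟩)
  · intro hT
    obtain ⟨hj0, hji⟩ := hM j hx
    exact h _ (Finsupp.single_le_iff.2 (Nat.one_le_iff_ne_zero.2 (Finsupp.mem_support_iff.1 hx)))
      (mem_calT.2 (Or.inr (Or.inl ⟨j, hj0, hji, hT, rfl⟩)))

/-- A tuple of value in `Φ` with positive last entry lies above a reduced one. -/
lemma exists_isReduced {ι : Type*} {Φ : AddSubmonoid ℚ} {w : ι → ℚ} {μ : ℚ} {a : ι →₀ ℕ} {c : ℕ}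
    (hc : 0 < c) (h : weight w a + (c : ℚ) * μ ∈ Φ) :
    ∃ b e, b ≤ a ∧ 0 < e ∧ e ≤ c ∧ IsReduced Φ w μ b e := by
  induction hn : a.degree + c using Nat.strong_induction_on generalizing a c with
  | _ n ih =>
    by_cases hr : IsReduced Φ w μ a c
    · exact ⟨a, c, le_rfl, hc, le_rfl, hr⟩
    · simp only [IsReduced, not_and, not_forall, not_not] at hr
      obtain ⟨b, e, hb, he, hec, hlt, hmem⟩ := hr h
      obtain ⟨b', e', hb', he', hec', hred⟩ := ih _ (hn ▸ hlt) he hmem rfl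
      exact ⟨b', e', hb'.trans hb, he', hec'.trans hec, hred⟩

lemma leadMon_apply_inr {i : ℕ} {d : Mon × ℕ} (hd : d ∈ D v P T i) :
    leadMon v P T i d (Sum.inr i) = d.2 * s v P T i := by
  have : d.1 (Sum.inr i) = 0 := by
    by_contra h
    rcases hd.2.1 (Finsupp.mem_support_iff.2 h) with ⟨j, -, hj⟩ | ⟨j, -, hj, hj'⟩
    · exact Sum.inr_ne_inl hj
    · exact hj.ne (Sum.inr_injective hj').symm
  simp [leadMon, this]

end Irreducible

/-! ### Irreducible monomials have distinct values -/

section Unique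

variable {R K : Type*} [CommRing R] [Field K] [Algebra R K]
  {v : AddValuation K (WithTop ℚ)} {P T : ℕ → R}

lemma weight_mem_S_sup_U {k i : ℕ} {M : Mon} (hM : ↑M.support ⊆ vars k i) :
    weight (varVal v P T) M ∈ S v P k ⊔ U v T (i - 1) := by
  refine weight_mem fun x hx => ?_
  rcases hM hx with ⟨j, hj, rfl⟩ | ⟨j, hj0, hj, rfl⟩
  · exact (le_sup_left : S v P k ≤ _) (val_mem_S hj)
  · exact (le_sup_right : U v T (i - 1) ≤ S v P k ⊔ U v T (i - 1)) (val_mem_U hj0 (by omega))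

/-- If `T_i` is the last of the `T`'s in which two monomials of equal value differ, then the one
with the larger exponent of `T_i` is divisible by the monomial of an element of `𝒟_i`. -/
lemma exponent_le_of_weight_eq (hβ : 0 < val v (P 0)) {M N : Mon}
    (hM : ∀ i, IsIrred (calT v P T i) M) (hN : ∀ i, IsIrred (calT v P T i) N)
    (h0 : M (Sum.inr 0) = N (Sum.inr 0))
    (h : weight (varVal v P T) M = weight (varVal v P T) N) {i : ℕ}
    (hi : ∀ j, i < j → M (Sum.inr j) = N (Sum.inr j)) : M (Sum.inr i) ≤ N (Sum.inr i) := by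
  classical
  by_contra! hlt
  have hi0 : 0 < i := Nat.pos_of_ne_zero fun h' => by
    subst h'
    omega
  set d : Var →₀ ℤ := toInt M - toInt N with hd
  have hdx : ∀ x, d x = (M x : ℤ) - N x := fun x => rfl
  have hd0 : zweight (varVal v P T) d = 0 := by
    rw [hd, map_sub, zweight_toInt, zweight_toInt, h, sub_self]
  set u := d.filter fun x => x.isLeft with hu
  set t := d.filter fun x => ¬ x.isLeft with ht
  have hut : u + t = d := Finsupp.filter_add_filter_not d _
  have htsupp : ∀ x ∈ t.support, ∃ j, 0 < j ∧ j ≤ i ∧ x = Sum.inr j := by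
    rintro (j | j) hx
    · simp [ht] at hx
    · have hj : d (Sum.inr j) ≠ 0 := by simpa [ht] using hx
      rw [hdx] at hj
      refine ⟨j, Nat.pos_of_ne_zero ?_, ?_, rfl⟩
      · rintro rfl
        omega
      · by_contra! hij
        have := hi j hij
        omega
  have husupp : ∀ x ∈ u.support, ∃ j, x = Sum.inl j := by
    rintro (j | j) hx
    · exact ⟨j, rfl⟩
    · simp [hu] at hx
  have hux : ∀ j, u (Sum.inl j) = (M (Sum.inl j) : ℤ) - N (Sum.inl j) := fun j =>
    Finsupp.filter_apply_pos _ _ rfl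
  have htx : ∀ j, t (Sum.inr j) = d (Sum.inr j) := fun j =>
    Finsupp.filter_apply_pos _ _ (by simp)
  have hsum : zweight (varVal v P T) u + zweight (varVal v P T) t = 0 := by
    rw [← map_add, hut, hd0]
  have hwt : zweight (varVal v P T) t ∈ H v T i := zweight_mem fun x hx => by
    obtain ⟨j, hj0, hj, rfl⟩ := htsupp x hx
    exact val_mem_H hj0 hj
  have hwu : zweight (varVal v P T) u ∈ GInf v P := zweight_mem fun x hx => by
    obtain ⟨j, rfl⟩ := husupp x hx
    exact val_mem_GInf j
  -- the two monomials agree in the `P_j` with `j > m_i`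
  have hP : ∀ j, m v P T i < j → M (Sum.inl j) = N (Sum.inl j) := by
    intro j hj
    have hmem : zweight (varVal v P T) u ∈ G v P (m v P T i) := by
      refine mem_G_m_of_mem_H hβ i ?_ hwu
      rw [eq_neg_of_add_eq_zero_left hsum]
      exact neg_mem hwt
    have hq : ∀ j, 0 < j → |u (Sum.inl j)| < q v P j := by
      intro j hj
      have h1 := (hM 0).lt_q hj
      have h2 := (hN 0).lt_q hj
      rw [hux, abs_lt]
      omega
    have h4 := coeff_eq_zero_of_mem_G hβ husupp hq hmem hj
    rw [hux] at h4
    omega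
  -- the exponents of `T_i` differ by a multiple of `s_i`
  have hdvd : (s v P T i : ℤ) ∣ d (Sum.inr i) := by
    refine s_dvd hβ ?_
    rw [zweight_eq_add_erase t (Sum.inr i), htx, varVal_inr] at hsum
    have hrest : zweight (varVal v P T) (t.erase (Sum.inr i)) ∈ H v T (i - 1) := by
      refine zweight_mem fun x hx => ?_
      rw [Finsupp.support_erase, Finset.mem_erase] at hx
      obtain ⟨j, hj0, hj, rfl⟩ := htsupp x hx.2
      have : j ≠ i := fun h => hx.1 (h ▸ rfl)
      exact val_mem_H hj0 (by omega)
    refine AddSubgroup.mem_sup.2 ⟨_, neg_mem hrest, _, neg_mem hwu, ?_⟩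
    linarith
  obtain ⟨c, hc⟩ : ∃ c : ℕ, M (Sum.inr i) - N (Sum.inr i) = c * s v P T i := by
    rw [hdx, ← Nat.cast_sub hlt.le, Int.natCast_dvd_natCast] at hdvd
    obtain ⟨c, hc⟩ := hdvd
    exact ⟨c, hc.trans (mul_comm _ _)⟩
  have hc0 : 0 < c := Nat.pos_of_ne_zero fun h' => by
    rw [h', zero_mul] at hc
    omega
  set a : Mon := (M - N).erase (Sum.inr i) with ha
  have hMN : Finsupp.single (Sum.inr i) (c * s v P T i) + a = M - N := by
    rw [← hc, ha, ← Finsupp.tsub_apply, Finsupp.single_add_erase]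
  have hvars : ∀ x, x ≠ Sum.inr i → M x ≠ N x → x ∈ vars (m v P T i) i := by
    rintro (j | j) hx hne
    · refine Or.inl ⟨j, ?_, rfl⟩
      by_contra! hj
      exact hne (hP j hj)
    · refine Or.inr ⟨j, Nat.pos_of_ne_zero ?_, ?_, rfl⟩
      · rintro rfl
        exact hne h0
      · by_contra! hij
        rcases hij.eq_or_lt with rfl | hij
        · exact hx rfl
        · exact hne (hi j hij)
  have hmem : weight (varVal v P T) a + (c : ℚ) * ((s v P T i : ℚ) * val v (T i)) ∈
      S v P (m v P T i) ⊔ U v T (i - 1) := by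
    have h1 : weight (varVal v P T) (M - N) = weight (varVal v P T) (N - M) := by
      have h2 : M - N + N = N - M + M := by
        ext x
        simp only [Finsupp.add_apply, Finsupp.tsub_apply]
        omega
      have h3 := congrArg (weight (varVal v P T)) h2
      rw [weight_add, weight_add, h] at h3
      linarith
    have h4 : weight (varVal v P T) a + (c : ℚ) * ((s v P T i : ℚ) * val v (T i)) =
        weight (varVal v P T) (N - M) := by
      rw [← h1, ← hMN, weight_add, weight_single]
      rw [varVal_inr]
      push_cast
      ring
    rw [h4]
    refine weight_mem_S_sup_U fun x hx => ?_
    have hx' : N x - M x ≠ 0 := by simpa using hx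
    refine hvars x ?_ (by omega)
    rintro rfl
    omega
  obtain ⟨b, e, hb, he, hec, hred⟩ := exists_isReduced hc0 hmem
  have haM : a ≤ M := fun x => by
    by_cases hx : x = Sum.inr i <;> simp [ha, hx, Finsupp.erase_ne]
  have hD : (b, e) ∈ D v P T i := by
    refine ⟨fun hT => ?_, fun x hx => ?_, he, hred, (hM i).of_le (hb.trans haM)⟩
    · refine hM (i + 1) _ (Finsupp.single_le_iff.2 ?_)
        (mem_calT.2 (Or.inr (Or.inl ⟨i, hi0, i.lt_succ_self, hT, rfl⟩)))
      omega
    · have hax : a x ≠ 0 := fun h' => by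
        have := hb x
        have hbx : b x ≠ 0 := by simpa using hx
        omega
      have hxi : x ≠ Sum.inr i := by
        rintro rfl
        simp [ha] at hax
      refine hvars x hxi fun h' => hax ?_
      simp [ha, Finsupp.erase_ne hxi, h']
  refine hM (i + 1) (leadMon v P T i (b, e)) ?_
    (mem_calT.2 (Or.inr (Or.inr ⟨i, hi0, i.lt_succ_self, _, hD, rfl⟩)))
  calc leadMon v P T i (b, e) ≤ a + Finsupp.single (Sum.inr i) (c * s v P T i) :=
        add_le_add hb (Finsupp.single_le_single.2 (Nat.mul_le_mul_right _ hec))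
    _ = M - N := by rw [add_comm, hMN]
    _ ≤ M := tsub_le_self

/-- Irreducible monomials of equal value are equal. -/
theorem eq_of_weight_eq (hβ : 0 < val v (P 0)) {M N : Mon}
    (hM : ∀ i, IsIrred (calT v P T i) M) (hN : ∀ i, IsIrred (calT v P T i) N)
    (h0 : M (Sum.inr 0) = N (Sum.inr 0))
    (h : weight (varVal v P T) M = weight (varVal v P T) N) : M = N := by
  classical
  have hT : ∀ i, M (Sum.inr i) = N (Sum.inr i) := by
    by_contra! hne
    obtain ⟨i, hi⟩ := hne
    have hfin : {j : ℕ | M (Sum.inr j) ≠ N (Sum.inr j)}.Finite := by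
      refine ((M.support ∪ N.support).finite_toSet.preimage
        (Sum.inr_injective (α := ℕ)).injOn).subset fun j hj => ?_
      simp only [Set.mem_preimage, Finset.mem_coe, Finset.mem_union, Finsupp.mem_support_iff]
      simp only [Set.mem_ofPred_eq] at hj
      omega
    obtain ⟨l, hl, hmax⟩ := Set.exists_max_image _ id hfin ⟨i, hi⟩
    have heq : ∀ j, l < j → M (Sum.inr j) = N (Sum.inr j) := fun j hj => by
      by_contra hne
      exact absurd (hmax j hne) (not_le.2 hj)
    exact hl (le_antisymm (exponent_le_of_weight_eq hβ hM hN h0 h heq)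
      (exponent_le_of_weight_eq hβ hN hM h0.symm h.symm fun j hj => (heq j hj).symm))
  set d : Var →₀ ℤ := toInt M - toInt N with hd
  have hdx : ∀ x, d x = (M x : ℤ) - N x := fun x => rfl
  have hd0 : zweight (varVal v P T) d = 0 := by
    rw [hd, map_sub, zweight_toInt, zweight_toInt, h, sub_self]
  have hsupp : ∀ x ∈ d.support, ∃ j, x = Sum.inl j := by
    rintro (j | j) hx
    · exact ⟨j, rfl⟩
    · rw [Finsupp.mem_support_iff, hdx, hT j] at hx
      omega
  have hP : ∀ j, 0 < j → d (Sum.inl j) = 0 := fun j hj => by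
    refine coeff_eq_zero_of_mem_G (T := T) hβ hsupp ?_ (i := 0) (hd0 ▸ zero_mem _) hj
    intro j hj
    have h1 := (hM 0).lt_q hj
    have h2 := (hN 0).lt_q hj
    rw [hdx, abs_lt]
    omega
  have hd1 : d = Finsupp.single (Sum.inl 0) (d (Sum.inl 0)) := by
    ext (j | j)
    · rcases Nat.eq_zero_or_pos j with rfl | hj
      · simp
      · rw [hP j hj, Finsupp.single_eq_of_ne (by simp [hj.ne'])]
    · rw [Finsupp.single_eq_of_ne (by simp), hdx, hT j]
      omega
  have hd2 : d (Sum.inl 0) = 0 := by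
    rw [hd1] at hd0
    simpa [hβ.ne'] using hd0
  ext x
  have hx : d x = 0 := by
    rw [hd1, hd2]
    simp
  rw [hdx] at hx
  omega

lemma finite_vars (k i : ℕ) : (vars k i).Finite := by
  refine (((Set.finite_Iic k).image Sum.inl).union ((Set.finite_Iio i).image Sum.inr)).subset ?_
  rintro x (⟨j, hj, rfl⟩ | ⟨j, -, hj, rfl⟩)
  exacts [Or.inl ⟨j, hj, rfl⟩, Or.inr ⟨j, hj, rfl⟩]

/-- By Dickson's lemma `𝒟_i` is finite, since reduced tuples are pairwise incomparable. -/
lemma finite_D (i : ℕ) : (D v P T i).Finite := by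
  have hV := (finite_vars (m v P T i) i).to_subtype
  let f : Mon × ℕ → (vars (m v P T i) i →₀ ℕ) × ℕ := fun d =>
    (d.1.subtypeDomain (· ∈ vars (m v P T i) i), d.2)
  have hle : ∀ d ∈ D v P T i, ∀ e, f d ≤ f e → d ≤ e := by
    intro d hd e h
    refine ⟨fun x => ?_, h.2⟩
    by_cases hx : x ∈ vars (m v P T i) i
    · exact h.1 ⟨x, hx⟩
    · rw [Finsupp.notMem_support_iff.1 fun h' => hx (hd.2.1 h')]
      exact Nat.zero_le _
  have hanti : ∀ d ∈ D v P T i, ∀ e ∈ D v P T i, d ≤ e → d = e := by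
    intro d hd e he h
    have hdeg : d.1.degree ≤ e.1.degree := Finsupp.degree_mono h.1
    have h2 : d.2 ≤ e.2 := h.2
    have hnot : ¬ d.1.degree + d.2 < e.1.degree + e.2 := fun hlt =>
      he.2.2.2.1.2 d.1 d.2 h.1 hd.2.2.1 h.2 hlt hd.2.2.2.1.1
    refine Prod.ext ?_ (by omega)
    have hsum : e.1.degree = d.1.degree + (e.1 - d.1).degree := by
      rw [← map_add, add_tsub_cancel_of_le h.1]
    have h3 : (e.1 - d.1).degree = 0 := by omega
    rw [Finsupp.degree_eq_zero_iff] at h3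
    exact le_antisymm h.1 (tsub_eq_zero_iff_le.1 h3)
  have hA : IsAntichain (· ≤ ·) (f '' D v P T i) := by
    rintro _ ⟨d, hd, rfl⟩ _ ⟨e, he, rfl⟩ hne h
    exact hne (congrArg f (hanti d hd e he (hle d hd e h)))
  refine Set.Finite.of_finite_image (f := f) ?_ fun d hd e he h => ?_
  · exact WellQuasiOrderedLE.finite_of_isAntichain hA
  · exact le_antisymm (hle d hd e h.le) (hle e he d h.ge)

end Unique

/-! ### Rewriting of reducible monomials -/

section Rewrite

variable {k R K : Type*} [Field k] [CommRing R] [Field K] [Algebra k K] [Algebra k R]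
  [Algebra R K] [IsScalarTower k R K] {v : AddValuation K (WithTop ℚ)} {P T : ℕ → R}

lemma vars_mono {a b i j : ℕ} (hab : a ≤ b) (hij : i ≤ j) : vars a i ⊆ vars b j := by
  rintro x (⟨l, hl, rfl⟩ | ⟨l, hl0, hl, rfl⟩)
  exacts [Or.inl ⟨l, by omega, rfl⟩, Or.inr ⟨l, hl0, by omega, rfl⟩]

omit [Algebra k R] [IsScalarTower k R K] in
lemma IsIrred.evalMon_ne_zero_of_vars (hv : IsRational k R v) (hβ : 0 < val v (P 0)) {a i : ℕ}
    {M : Mon} (h : IsIrred (calT v P T i) M) (hM : ↑M.support ⊆ vars a i) : evalMon P T M ≠ 0 := by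
  refine h.evalMon_ne_zero hv (fun h0 => by simp [h0] at hβ) fun j hj => ?_
  rcases hM hj with ⟨l, -, hl⟩ | ⟨l, hl0, hl, hl'⟩
  · cases hl
  · cases hl'
    exact ⟨hl0, hl⟩

omit [Algebra k R] [IsScalarTower k R K] in
lemma evalMon_leadMon_ne_zero (hv : IsRational k R v) (hβ : 0 < val v (P 0)) {i : ℕ} {d : Mon × ℕ}
    (hd : d ∈ D v P T i) : evalMon P T (leadMon v P T i d) ≠ 0 := by
  have := isDomain_of_isRational hv
  rw [leadMon, evalMon_add, evalMon_single]
  exact mul_ne_zero (hd.2.2.2.2.evalMon_ne_zero_of_vars hv hβ hd.2.1) (pow_ne_zero _ hd.1)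

lemma absVal_eq (i : ℕ) (d : Mon × ℕ) : absVal v P T i d =
    weight (varVal v P T) d.1 + (d.2 : ℚ) * ((s v P T i : ℚ) * val v (T i)) := by
  simp only [absVal, leadMon, weight_add, weight_single, varVal_inr]
  push_cast
  ring

lemma monLT_leadMon (hβ : 0 < val v (P 0)) {i a : ℕ} {d : Mon × ℕ} (hd : d ∈ D v P T i) {N : Mon}
    (hN : ↑N.support ⊆ vars a i) : MonLT N (leadMon v P T i d) := by
  refine monLT_of_forall_lt (x := Sum.inr i) ?_ ?_ ?_
  · rw [leadMon_apply_inr hd]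
    exact Nat.mul_pos hd.2.2.1 (s_pos hβ i)
  · intro y hy
    rcases hN hy with ⟨j, -, rfl⟩ | ⟨j, -, hj, rfl⟩
    exacts [Sum.Lex.sep _ _, Sum.Lex.inr hj]
  · rintro (j | j) hj
    · cases hj
    replace hj : i < j := by simpa using hj
    have h1 : d.1 (Sum.inr j) = 0 := by
      by_contra h
      rcases hd.2.1 (Finsupp.mem_support_iff.2 h) with ⟨l, -, hl⟩ | ⟨l, -, hl, hl'⟩
      · cases hl
      · cases hl'
        omega
    simp [leadMon, h1, hj.ne']

lemma PStep.monLT (hβ : 0 < val v (P 0)) {j : ℕ} {N : Mon}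
    (hN : ∀ x ∈ N.support, ∃ l < j, x = Sum.inl l) :
    MonLT N (Finsupp.single (Sum.inl j) (q v P j)) := by
  refine monLT_of_forall_lt (x := Sum.inl j) ?_ ?_ ?_
  · simpa using q_pos hβ j
  · intro y hy
    obtain ⟨l, hl, rfl⟩ := hN y hy
    exact Sum.Lex.inl hl
  · intro y hy
    refine Finsupp.single_eq_of_ne ?_
    rintro rfl
    cases hy
    exact lt_irrefl _ ‹_›

variable (hv : IsRational k R v) (hβ : 0 < val v (P 0)) (hP : ∀ i, 0 < i → PStep v k P T i)
include hv hβ hP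

/-- An element of `𝒯_i` is equal to a smaller monomial of the same value, up to a constant factor
and to a jumping polynomial of larger value. -/
lemma exists_rewrite {i : ℕ}
    (hT : ∀ l, 0 < l → l < i → ∀ d ∈ D v P T l, ∃ j, 0 < j ∧ IsTd v k P T l d (T j)) {L : Mon}
    (hL : L ∈ calT v P T i) :
    ∃ N, MonLT N L ∧ weight (varVal v P T) N = weight (varVal v P T) L ∧
      N (Sum.inr 0) = 0 ∧
      (↑L.support ⊆ vars (m v P T i) i → ↑N.support ⊆ vars (m v P T i) i) ∧
      (evalMon P T L = 0 ∨ ∃ (x : Var) (c : k), x ≠ Sum.inr 0 ∧ evalMon P T N ≠ 0 ∧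
        evalMon P T L = Sum.elim P T x + algebraMap k R c * evalMon P T N ∧
        v (algebraMap R K (evalMon P T L)) < v (algebraMap R K (Sum.elim P T x))) := by
  rcases mem_calT.1 hL with ⟨j, hj, rfl⟩ | ⟨l, hl, hli, h0, rfl⟩ | ⟨l, hl, hli, d, hd, rfl⟩
  · obtain ⟨N, c, hN, hw, hirr, hres, heq⟩ := hP j hj
    refine ⟨N, PStep.monLT hβ hN, ?_, ?_, fun hLs x hx => ?_, ?_⟩
    · simp [hw]
    · by_contra h
      obtain ⟨l, -, hl⟩ := hN _ (Finsupp.mem_support_iff.2 h)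
      cases hl
    · obtain ⟨l, hl, rfl⟩ := hN x hx
      have hjs : Sum.inl j ∈ vars (m v P T i) i := hLs (by simpa using (q_pos hβ j).ne')
      rcases hjs with ⟨j', hj', hjj⟩ | ⟨j', -, -, hjj⟩
      · cases hjj
        exact Or.inl ⟨l, by omega, rfl⟩
      · cases hjj
    · refine or_iff_not_imp_left.2 fun hne => ?_
      have hN0 : evalMon P T N ≠ 0 := evalMon_ne_zero hv fun x hx => by
        obtain ⟨l, hl, rfl⟩ := hN x hx
        exact hirr.P_ne_zero (fun h0 => by simp [h0] at hβ) hl hx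
      refine ⟨Sum.inl (j + 1), c, by simp, hN0, ?_, ?_⟩
      · simp [heq]
      · rw [v_evalMon hv hne]
        have := lt_sub_of_isResidue hv hN0 hres
        rw [← heq, v_evalMon hv hN0, ← hw] at this
        simpa using this
  · refine ⟨0, ?_, by simp [h0], by simp, by simp, Or.inl (by simp [h0])⟩
    exact ⟨Sum.inr l, fun y hy => (Finsupp.single_eq_of_ne (by
      rintro rfl
      cases hy
      exact lt_irrefl _ ‹_›)).symm, by simp⟩
  · obtain ⟨j, hj, N, c, hN, hw, hirr, hres, heq⟩ := hT l hl hli d hd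
    have hN0 : evalMon P T N ≠ 0 := hirr.evalMon_ne_zero_of_vars hv hβ hN
    refine ⟨N, monLT_leadMon hβ hd hN, hw.symm, ?_, fun _ =>
      hN.trans (vars_mono (m_mono hli.le) hli.le), Or.inr ⟨Sum.inr j, c, ?_, hN0, ?_, ?_⟩⟩
    · by_contra h
      rcases hN (Finsupp.mem_support_iff.2 h) with ⟨a, -, ha⟩ | ⟨a, ha0, -, ha⟩
      · cases ha
      · cases ha
        exact lt_irrefl _ ha0
    · intro h
      cases h
      exact lt_irrefl _ hj
    · simp [heq]
    · rw [v_evalMon hv (evalMon_leadMon_ne_zero hv hβ hd)]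
      have := lt_sub_of_isResidue hv hN0 hres
      rw [← heq, v_evalMon hv hN0, ← hw] at this
      exact this

/-- Every value in the semigroup `S_{m_i} + U_{i-1}` is the value of an irreducible monomial: the
smallest monomial of that value is irreducible. -/
lemma exists_irred_of_mem {i : ℕ}
    (hT : ∀ l, 0 < l → l < i → ∀ d ∈ D v P T l, ∃ j, 0 < j ∧ IsTd v k P T l d (T j)) {g : ℚ}
    (hg : g ∈ S v P (m v P T i) ⊔ U v T (i - 1)) :
    ∃ N : Mon, ↑N.support ⊆ vars (m v P T i) i ∧ weight (varVal v P T) N = g ∧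
      IsIrred (calT v P T i) N := by
  have hle : S v P (m v P T i) ⊔ U v T (i - 1) ≤
      AddSubmonoid.closure (varVal v P T '' vars (m v P T i) i) := by
    refine sup_le (AddSubmonoid.closure_mono ?_) (AddSubmonoid.closure_mono ?_)
    · rintro _ ⟨j, hj, rfl⟩
      exact ⟨Sum.inl j, Or.inl ⟨j, hj, rfl⟩, rfl⟩
    · rintro _ ⟨j, hj, rfl⟩
      have h1 : 1 ≤ j := hj.1
      have h2 : j ≤ i - 1 := hj.2
      exact ⟨Sum.inr j, Or.inr ⟨j, h1, by omega, rfl⟩, rfl⟩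
  obtain ⟨N, ⟨hN, hw⟩, hmin⟩ := wellFounded_monLT.has_min
    {N : Mon | (N.support : Set Var) ⊆ vars (m v P T i) i ∧ weight (varVal v P T) N = g}
    (exists_weight_of_mem_closure (hle hg))
  refine ⟨N, hN, hw, fun L hLN hL => ?_⟩
  obtain ⟨N', hlt, hw', -, hs, -⟩ := exists_rewrite hv hβ hP hT hL
  have hsplit : L + (N - L) = N := add_tsub_cancel_of_le hLN
  refine hmin (N' + (N - L)) ⟨?_, ?_⟩ ?_
  · classical
    intro x hx
    rcases Finset.mem_union.1 (Finsupp.support_add hx) with h | h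
    · exact hs ((Finset.coe_subset.2 (Finsupp.support_mono hLN)).trans hN) h
    · exact hN (Finsupp.support_mono tsub_le_self h)
  · rw [weight_add, hw', ← weight_add, hsplit, hw]
  · have := hlt.add_right (N - L)
    rwa [hsplit] at this

end Rewrite

/-! ### Finiteness of the values below a bound -/

section Values

variable {k R K : Type*} [Field k] [CommRing R] [Field K] [Algebra k K]
  [Algebra R K] {v : AddValuation K (WithTop ℚ)}

/-- The ideal `I_σ` of the elements of value at least `σ`. -/
def valIdeal (hv : IsRational k R v) (σ : WithTop ℚ) : Ideal R where
  carrier := {f | σ ≤ v (algebraMap R K f)}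
  add_mem' {f g} hf hg := by
    simp only [Set.mem_ofPred_eq, map_add] at *
    exact AddValuation.map_le_add v hf hg
  zero_mem' := by simp
  smul_mem' c f hf := by
    simp only [Set.mem_ofPred_eq, smul_eq_mul, map_mul, AddValuation.map_mul] at *
    exact hf.trans (le_add_of_nonneg_left (hv.nonneg c))

lemma mem_valIdeal {hv : IsRational k R v} {σ : WithTop ℚ} {f : R} :
    f ∈ valIdeal hv σ ↔ σ ≤ v (algebraMap R K f) := Iff.rfl

/-- There is no infinite increasing sequence of values below `σ`, because the ideals `I_τ` with
`τ ≤ σ` correspond to ideals of an Artinian quotient of `R`. -/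
lemma wellFounded_val_lt [IsLocalRing R] [IsNoetherianRing R] (hv : IsRational k R v)
    {σ : WithTop ℚ} {n : ℕ} (hn : IsLocalRing.maximalIdeal R ^ n ≤ valIdeal hv σ) :
    WellFounded fun f g : R => v (algebraMap R K g) < v (algebraMap R K f) ∧
      v (algebraMap R K g) < σ := by
  set 𝔞 := IsLocalRing.maximalIdeal R ^ n with h𝔞
  have hwf : WellFoundedLT (Ideal (R ⧸ 𝔞)) := by
    by_cases hntop : 𝔞 = ⊤
    · have : Subsingleton (R ⧸ 𝔞) := Ideal.Quotient.subsingleton_iff.2 hntop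
      infer_instance
    · have : Nontrivial (R ⧸ 𝔞) := Ideal.Quotient.nontrivial_iff.2 hntop
      have : IsLocalRing (R ⧸ 𝔞) :=
        IsLocalRing.of_surjective' (Ideal.Quotient.mk 𝔞) Ideal.Quotient.mk_surjective
      have : IsArtinianRing (R ⧸ 𝔞) := by
        rw [isArtinianRing_iff_isNilpotent_maximalIdeal]
        refine ⟨n, ?_⟩
        rw [← IsLocalRing.map_maximalIdeal_of_surjective (Ideal.Quotient.mk 𝔞)
          Ideal.Quotient.mk_surjective, ← Ideal.map_pow, ← h𝔞]
        exact Ideal.map_quotient_self 𝔞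
      infer_instance
  let F : R → Ideal (R ⧸ 𝔞) := fun f =>
    (valIdeal hv (min (v (algebraMap R K f)) σ)).map (Ideal.Quotient.mk 𝔞)
  refine Subrelation.wf (r := InvImage (· < ·) F) ?_ (InvImage.wf F hwf.wf)
  rintro f g ⟨hlt, hσ⟩
  have hcomap : ∀ f, (F f).comap (Ideal.Quotient.mk 𝔞) =
      valIdeal hv (min (v (algebraMap R K f)) σ) := fun f => by
    rw [Ideal.comap_map_of_surjective' _ Ideal.Quotient.mk_surjective, Ideal.mk_ker, sup_eq_left]
    exact fun h hh => mem_valIdeal.2 ((min_le_right _ _).trans (hn hh))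
  have hlt' : min (v (algebraMap R K g)) σ < min (v (algebraMap R K f)) σ := by
    rw [min_eq_left hσ.le]
    exact lt_min hlt hσ
  refine lt_of_le_of_ne (Ideal.map_mono fun h hh => hlt'.le.trans hh) fun heq => ?_
  have hg : g ∈ (F f).comap (Ideal.Quotient.mk 𝔞) := by
    rw [heq, hcomap]
    exact mem_valIdeal.2 (min_le_left _ _)
  rw [hcomap, mem_valIdeal] at hg
  exact absurd hg (not_le.2 (by rwa [min_eq_left hσ.le] at hlt'))

end Values

/-! ### Generation by all jumping polynomials -/

section Generation

variable {k R K : Type*} [Field k] [CommRing R] [Field K] [Algebra k K] [Algebra k R]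
  [Algebra R K] [IsScalarTower k R K] {v : AddValuation K (WithTop ℚ)} {P T : ℕ → R}

variable (v P T) in
/-- The ideal generated by the monomials of value at least `σ` in the variables `P_j` and `T_j`,
where `T_0` is excluded. -/
def monIdeal (σ : WithTop ℚ) : Ideal R :=
  Ideal.span {f | ∃ M : Mon, M (Sum.inr 0) = 0 ∧ f = evalMon P T M ∧ σ ≤ v (algebraMap R K f)}

variable (v P T) in
/-- The irreducible monomials, without `T_0`. -/
def irredSet : Set Mon := {M | M (Sum.inr 0) = 0 ∧ ∀ i, IsIrred (calT v P T i) M}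

omit [Algebra k R] [IsScalarTower k R K] in
lemma irredSet.evalMon_ne_zero (hv : IsRational k R v) (hβ : 0 < val v (P 0)) {M : Mon}
    (hM : M ∈ irredSet v P T) : evalMon P T M ≠ 0 := by
  refine JumpingPolynomials.evalMon_ne_zero hv fun x hx => ?_
  rw [← pow_one (Sum.elim P T x), ← evalMon_single]
  have hle : Finsupp.single x 1 ≤ M :=
    Finsupp.single_le_iff.2 (Nat.one_le_iff_ne_zero.2 (Finsupp.mem_support_iff.1 hx))
  rcases x with j | j
  · refine ((hM.2 0).of_le hle).evalMon_ne_zero hv (fun h0 => by simp [h0] at hβ) ?_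
    simp
  · refine ((hM.2 (j + 1)).of_le hle).evalMon_ne_zero hv (fun h0 => by simp [h0] at hβ) ?_
    intro l hl
    obtain rfl : l = j := by
      by_contra h
      exact h (by simpa [Finsupp.single_apply, eq_comm] using hl)
    refine ⟨Nat.pos_of_ne_zero ?_, l.lt_succ_self⟩
    rintro rfl
    exact Finsupp.mem_support_iff.1 hx hM.1

omit [Algebra k R] [IsScalarTower k R K] in
lemma monIdeal_le (hv : IsRational k R v) (σ : WithTop ℚ) : monIdeal v P T σ ≤ valIdeal hv σ := by
  refine Ideal.span_le.2 ?_
  rintro _ ⟨M, -, -, h⟩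
  exact h

lemma v_smul (hv : IsRational k R v) {c : k} (hc : c ≠ 0) (f : R) :
    v (algebraMap R K (c • f)) = v (algebraMap R K f) := by
  rw [Algebra.smul_def, map_mul, AddValuation.map_mul, ← IsScalarTower.algebraMap_apply k R K,
    hv.map_const c hc, zero_add]

/-- A nontrivial `k`-linear combination of irreducible monomials has the value of one of them, as
their values are pairwise distinct. -/
lemma exists_v_linearCombination_eq (hv : IsRational k R v) (hβ : 0 < val v (P 0)) {l : Mon →₀ k}
    (hl : ∀ M ∈ l.support, M ∈ irredSet v P T) (h0 : l ≠ 0) :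
    ∃ M ∈ l.support, v (algebraMap R K (Finsupp.linearCombination k (evalMon P T) l)) =
      v (algebraMap R K (evalMon P T M)) := by
  classical
  obtain ⟨M, hM, hmin⟩ := Finset.exists_min_image l.support (weight (varVal v P T))
    (Finsupp.support_nonempty_iff.2 h0)
  refine ⟨M, hM, ?_⟩
  have hval : ∀ N ∈ l.support, v (algebraMap R K (l N • evalMon P T N)) =
      (weight (varVal v P T) N : ℚ) := fun N hN => by
    rw [v_smul hv (Finsupp.mem_support_iff.1 hN),
      v_evalMon hv (irredSet.evalMon_ne_zero hv hβ (hl N hN))]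
  rw [Finsupp.linearCombination_apply, Finsupp.sum, ← Finset.add_sum_erase _ _ hM, map_add,
    AddValuation.map_add_eq_of_lt_left, v_smul hv (Finsupp.mem_support_iff.1 hM)]
  rw [hval M hM, map_sum]
  refine AddValuation.map_lt_sum v (WithTop.coe_ne_top) fun N hN => ?_
  rw [Finset.mem_erase] at hN
  rw [hval N hN.2]
  refine WithTop.coe_lt_coe.2 (lt_of_le_of_ne (hmin N hN.2) fun h => hN.1 ?_)
  have h1 := hl N hN.2
  have h2 := hl M hM
  exact (eq_of_weight_eq hβ h2.2 h1.2 (h2.1.trans h1.1.symm) h).symm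

/-- Modulo the monomials of value at least `σ`, every monomial is a linear combination of
irreducible ones: a reducible monomial is the sum of a constant multiple of a smaller monomial of
the same value and of a monomial of larger value. -/
lemma evalMon_mem_span_sup [IsLocalRing R] [IsNoetherianRing R] (hv : IsRational k R v)
    (hβ : 0 < val v (P 0)) (hP : ∀ i, 0 < i → PStep v k P T i)
    (hT : ∀ l, 0 < l → ∀ d ∈ D v P T l, ∃ j, 0 < j ∧ IsTd v k P T l d (T j))
    {σ : WithTop ℚ} {n : ℕ} (hn : IsLocalRing.maximalIdeal R ^ n ≤ valIdeal hv σ) {M : Mon}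
    (hM : M (Sum.inr 0) = 0) :
    evalMon P T M ∈
      Submodule.span k (evalMon P T ''
        {N | N ∈ irredSet v P T ∧ v (algebraMap R K (evalMon P T N)) < σ}) ⊔
      (monIdeal v P T σ).restrictScalars k := by
  set B := Submodule.span k (evalMon P T ''
        {N | N ∈ irredSet v P T ∧ v (algebraMap R K (evalMon P T N)) < σ}) ⊔
      (monIdeal v P T σ).restrictScalars k with hB
  suffices H : ∀ f : R, ∀ M : Mon, M (Sum.inr 0) = 0 →
      v (algebraMap R K (evalMon P T M)) = v (algebraMap R K f) → evalMon P T M ∈ B from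
    H _ M hM rfl
  intro f
  induction f using (wellFounded_val_lt hv hn).induction with
  | _ f ihf =>
    intro M
    induction M using wellFounded_monLT.induction with
    | _ M ihM =>
      intro hM hMf
      rcases le_or_gt σ (v (algebraMap R K (evalMon P T M))) with hσ | hσ
      · exact Submodule.mem_sup_right (Ideal.subset_span ⟨M, hM, rfl, hσ⟩)
      by_cases hirr : ∀ i, IsIrred (calT v P T i) M
      · exact Submodule.mem_sup_left (Submodule.subset_span ⟨M, ⟨⟨hM, hirr⟩, hσ⟩, rfl⟩)
      obtain ⟨i, L, hLM, hL⟩ : ∃ i, ∃ L ≤ M, L ∈ calT v P T i := by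
        simpa [IsIrred] using hirr
      obtain ⟨N, hlt, hw, hN0, -, hrw⟩ := exists_rewrite hv hβ hP (fun l hl _ => hT l hl) hL
      have hsplit : L + (M - L) = M := add_tsub_cancel_of_le hLM
      have hM' : (M - L) (Sum.inr 0) = 0 := by simp [hM]
      by_cases hne : evalMon P T M = 0
      · rw [hne]
        exact zero_mem _
      have hne' := hne
      rw [← hsplit, evalMon_add] at hne'
      have hL0 := left_ne_zero_of_mul hne'
      have hM0 := right_ne_zero_of_mul hne'
      obtain ⟨x, c, hx, hNne, heq, hval⟩ := hrw.resolve_left hL0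
      have hdecomp : evalMon P T M =
          evalMon P T (Finsupp.single x 1 + (M - L)) + c • evalMon P T (N + (M - L)) := by
        conv_lhs => rw [← hsplit, evalMon_add, heq]
        rw [evalMon_add, evalMon_add, evalMon_single, pow_one, Algebra.smul_def]
        ring
      rw [hdecomp]
      refine add_mem ?_ (Submodule.smul_mem _ _ (ihM _ ?_ ?_ ?_))
      · refine ihf (evalMon P T (Finsupp.single x 1 + (M - L))) ⟨?_, hMf ▸ hσ⟩ _ ?_ rfl
        · rw [← hMf]
          conv_lhs => rw [← hsplit]
          simp only [evalMon_add, evalMon_single, pow_one, map_mul, AddValuation.map_mul]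
          rw [coe_val hv hM0]
          exact WithTop.add_lt_add_right WithTop.coe_ne_top hval
        · rw [Finsupp.add_apply, hM', Finsupp.single_eq_of_ne hx.symm]
      · have := hlt.add_right (M - L)
        rwa [hsplit] at this
      · rw [Finsupp.add_apply, hN0, hM']
      · rw [← hMf]
        conv_rhs => rw [← hsplit]
        simp only [evalMon_add, map_mul, AddValuation.map_mul]
        rw [v_evalMon hv hNne, v_evalMon hv hL0, hw]

lemma mul_mem_monIdeal {x : Var} (hx : x ≠ Sum.inr 0) {c τ : WithTop ℚ}
    (hc : c ≤ v (algebraMap R K (Sum.elim P T x))) {f : R} (hf : f ∈ monIdeal v P T τ) :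
    f * Sum.elim P T x ∈ monIdeal v P T (τ + c) := by
  induction hf using Submodule.span_induction with
  | mem f hf =>
    obtain ⟨M, hM, rfl, hv⟩ := hf
    refine Ideal.subset_span ⟨M + Finsupp.single x 1, ?_, ?_, ?_⟩
    · simp [hM, hx]
    · simp
    · rw [map_mul, AddValuation.map_mul]
      exact add_le_add hv hc
  | zero => simp
  | add f g _ _ hf hg =>
    rw [add_mul]
    exact add_mem hf hg
  | smul a f _ hf =>
    rw [smul_eq_mul, mul_assoc]
    exact Ideal.mul_mem_left _ _ hf

/-- The powers of the maximal ideal lie in the ideals generated by monomials. -/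
lemma pow_le_monIdeal [IsLocalRing R] (hm : IsLocalRing.maximalIdeal R = Ideal.span {P 0, P 1, T 1})
    {c : ℚ} (hx : (c : WithTop ℚ) ≤ v (algebraMap R K (P 0)))
    (hy : (c : WithTop ℚ) ≤ v (algebraMap R K (P 1)))
    (hz : (c : WithTop ℚ) ≤ v (algebraMap R K (T 1))) (n : ℕ) :
    IsLocalRing.maximalIdeal R ^ n ≤ monIdeal v P T ((n * c : ℚ) : WithTop ℚ) := by
  induction n with
  | zero =>
    have : (1 : R) ∈ monIdeal v P T (((0 : ℕ) * c : ℚ) : WithTop ℚ) :=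
      Ideal.subset_span ⟨0, by simp, by simp, by simp⟩
    rw [(Ideal.eq_top_iff_one _).2 this]
    exact le_top
  | succ n ih =>
    have hn : (((n + 1 : ℕ) * c : ℚ) : WithTop ℚ) = ((n * c : ℚ) : WithTop ℚ) + c := by
      rw [← WithTop.coe_add]
      exact congrArg WithTop.some (by push_cast; ring)
    rw [pow_succ, hn, Ideal.mul_le]
    intro f hf g hg
    rw [hm, Submodule.mem_span_triple] at hg
    obtain ⟨a, b, d, rfl⟩ := hg
    have h1 := mul_mem_monIdeal (x := Sum.inl 0) (by simp) hx (ih hf)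
    have h2 := mul_mem_monIdeal (x := Sum.inl 1) (by simp) hy (ih hf)
    have h3 := mul_mem_monIdeal (x := Sum.inr 1) (by simp) hz (ih hf)
    simp only [Sum.elim_inl, Sum.elim_inr] at h1 h2 h3
    have : f * (a • P 0 + b • P 1 + d • T 1) =
        a * (f * P 0) + b * (f * P 1) + d * (f * T 1) := by
      simp only [smul_eq_mul]
      ring
    rw [this]
    exact add_mem (add_mem (Ideal.mul_mem_left _ _ h1) (Ideal.mul_mem_left _ _ h2))
      (Ideal.mul_mem_left _ _ h3)

variable (k P T) in
/-- The `k`-linear span of the monomials. -/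
def monSpan : Submodule k R :=
  Submodule.span k (evalMon P T '' {M | M (Sum.inr 0) = 0})

omit [Algebra R K] [Field K] [Algebra k K] [IsScalarTower k R K] in
lemma mul_mem_monSpan {x : Var} (hx : x ≠ Sum.inr 0) {f : R} (hf : f ∈ monSpan k P T) :
    Sum.elim P T x * f ∈ monSpan k P T := by
  induction hf using Submodule.span_induction with
  | mem f hf =>
    obtain ⟨M, hM, rfl⟩ := hf
    refine Submodule.subset_span ⟨Finsupp.single x 1 + M, ?_, by simp⟩
    simp only [Set.mem_ofPred_eq] at hM ⊢
    simp [hM, hx]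
  | zero => simp
  | add f g _ _ hf hg =>
    rw [mul_add]
    exact add_mem hf hg
  | smul a f _ hf =>
    rw [mul_smul_comm]
    exact Submodule.smul_mem _ _ hf

/-- As `R` has the residue field `k`, it is spanned by monomials modulo any power of its maximal
ideal. -/
lemma exists_sub_mem_pow [IsLocalRing R] (hv : IsRational k R v)
    (hdom : ∀ f : R, f ∈ IsLocalRing.maximalIdeal R ↔ 0 < v (algebraMap R K f))
    (hm : IsLocalRing.maximalIdeal R = Ideal.span {P 0, P 1, T 1}) (n : ℕ) (f : R) :
    ∃ g ∈ monSpan k P T, f - g ∈ IsLocalRing.maximalIdeal R ^ n := by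
  induction n generalizing f with
  | zero => exact ⟨0, zero_mem _, by simp⟩
  | succ n ih =>
    obtain ⟨c, hc⟩ := hv.exists_residue (algebraMap R K f) (hv.nonneg f)
    rw [IsScalarTower.algebraMap_apply k R K, ← map_sub, ← hdom] at hc
    have hc' := hc
    rw [hm, Submodule.mem_span_triple] at hc'
    obtain ⟨a₁, a₂, a₃, ha⟩ := hc'
    obtain ⟨b₁, hb₁, h₁⟩ := ih a₁
    obtain ⟨b₂, hb₂, h₂⟩ := ih a₂
    obtain ⟨b₃, hb₃, h₃⟩ := ih a₃
    have hgen : ∀ t ∈ ({P 0, P 1, T 1} : Set R), t ∈ IsLocalRing.maximalIdeal R := fun t ht => by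
      rw [hm]
      exact Ideal.subset_span ht
    refine ⟨algebraMap k R c + P 0 * b₁ + P 1 * b₂ + T 1 * b₃, ?_, ?_⟩
    · refine add_mem (add_mem (add_mem ?_ (mul_mem_monSpan (x := Sum.inl 0) (by simp) hb₁))
        (mul_mem_monSpan (x := Sum.inl 1) (by simp) hb₂))
        (mul_mem_monSpan (x := Sum.inr 1) (by simp) hb₃)
      rw [Algebra.algebraMap_eq_smul_one]
      exact Submodule.smul_mem _ _ (Submodule.subset_span ⟨0, by simp, by simp⟩)
    · have : f - (algebraMap k R c + P 0 * b₁ + P 1 * b₂ + T 1 * b₃) =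
          (a₁ - b₁) * P 0 + (a₂ - b₂) * P 1 + (a₃ - b₃) * T 1 := by
        simp only [smul_eq_mul] at ha
        linear_combination -ha
      rw [this, pow_succ]
      exact add_mem (add_mem (Ideal.mul_mem_mul h₁ (hgen _ (by simp)))
        (Ideal.mul_mem_mul h₂ (hgen _ (by simp)))) (Ideal.mul_mem_mul h₃ (hgen _ (by simp)))

/-- The family of all jumping polynomials generates the ideals `I_σ`. -/
theorem valIdeal_le_monIdeal [IsLocalRing R] [IsNoetherianRing R] (hv : IsRational k R v)
    (hβ : 0 < val v (P 0)) (hP : ∀ i, 0 < i → PStep v k P T i)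
    (hT : ∀ l, 0 < l → ∀ d ∈ D v P T l, ∃ j, 0 < j ∧ IsTd v k P T l d (T j))
    (hdom : ∀ f : R, f ∈ IsLocalRing.maximalIdeal R ↔ 0 < v (algebraMap R K f))
    (hm : IsLocalRing.maximalIdeal R = Ideal.span {P 0, P 1, T 1}) (σ : ℚ) :
    valIdeal hv σ ≤ monIdeal v P T σ := by
  -- a positive lower bound for the values of the generators of the maximal ideal
  obtain ⟨c, hc, hcx, hcy, hcz⟩ : ∃ c : ℚ, 0 < c ∧ (c : WithTop ℚ) ≤ v (algebraMap R K (P 0)) ∧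
      (c : WithTop ℚ) ≤ v (algebraMap R K (P 1)) ∧
      (c : WithTop ℚ) ≤ v (algebraMap R K (T 1)) := by
    have hpos : ∀ t ∈ ({P 0, P 1, T 1} : Set R), 0 < v (algebraMap R K t) := fun t ht => by
      rw [← hdom, hm]
      exact Ideal.subset_span ht
    have hne : min (v (algebraMap R K (P 0))) (min (v (algebraMap R K (P 1)))
        (v (algebraMap R K (T 1)))) ≠ ⊤ := by
      refine ((min_le_left _ _).trans_lt ?_).ne
      rw [coe_val hv (fun h0 => by simp [h0] at hβ)]
      exact WithTop.coe_lt_top _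
    obtain ⟨c, hc⟩ := WithTop.ne_top_iff_exists.1 hne
    have h0 : (0 : WithTop ℚ) < c := by
      rw [hc]
      exact lt_min (hpos _ (by simp)) (lt_min (hpos _ (by simp)) (hpos _ (by simp)))
    refine ⟨c, by exact_mod_cast h0, ?_⟩
    rw [hc]
    exact ⟨min_le_left _ _, (min_le_right _ _).trans (min_le_left _ _),
      (min_le_right _ _).trans (min_le_right _ _)⟩
  obtain ⟨n, hn⟩ := exists_nat_ge (σ / c)
  have hpow : IsLocalRing.maximalIdeal R ^ n ≤ monIdeal v P T σ := by
    refine (pow_le_monIdeal hm hcx hcy hcz n).trans (Ideal.span_mono ?_)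
    rintro f ⟨M, hM, hf, h⟩
    refine ⟨M, hM, hf, le_trans (WithTop.coe_le_coe.2 ?_) h⟩
    rwa [div_le_iff₀ hc] at hn
  intro f hf
  obtain ⟨g, hg, hfg⟩ := exists_sub_mem_pow hv hdom hm n f
  have hspan : monSpan k P T ≤ Submodule.span k (evalMon P T ''
        {N | N ∈ irredSet v P T ∧ v (algebraMap R K (evalMon P T N)) < σ}) ⊔
      (monIdeal v P T σ).restrictScalars k := by
    refine Submodule.span_le.2 ?_
    rintro _ ⟨M, hM, rfl⟩
    exact evalMon_mem_span_sup hv hβ hP hT (hpow.trans (monIdeal_le hv _)) hM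
  obtain ⟨a, ha, b, hb, rfl⟩ := Submodule.mem_sup.1 (hspan hg)
  have hb : b ∈ monIdeal v P T σ := hb
  have hfa : f - a ∈ monIdeal v P T σ := by
    have := add_mem (hpow hfg) hb
    rwa [sub_add_eq_sub_sub, sub_add_cancel] at this
  -- the combination `a` of irreducible monomials of value less than `σ` has to vanish
  obtain ⟨l, hl, rfl⟩ := (Finsupp.mem_span_image_iff_linearCombination k).1 ha
  by_cases h0 : l = 0
  · simpa [h0] using hfa
  · have hl' : ∀ M ∈ l.support, M ∈ irredSet v P T ∧ v (algebraMap R K (evalMon P T M)) < σ :=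
      fun M hM => (Finsupp.mem_supported k l).1 hl hM
    obtain ⟨M, hM, hval⟩ := exists_v_linearCombination_eq hv hβ (fun M hM => (hl' M hM).1) h0
    have hge : Finsupp.linearCombination k (evalMon P T) l ∈ valIdeal hv σ := by
      have := sub_mem hf (monIdeal_le hv _ hfa)
      rwa [sub_sub_cancel] at this
    rw [mem_valIdeal, hval] at hge
    exact absurd hge (not_le.2 (hl' M hM).2)

end Generation

/-! ### Removal of the redundant polynomials -/

section Redundant

variable {k R K : Type*} [Field k] [CommRing R] [Field K] [Algebra k K] [Algebra k R]
  [Algebra R K] [IsScalarTower k R K] {v : AddValuation K (WithTop ℚ)} {P T : ℕ → R}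

/-- The condition on `T_i` in the construction of jumping polynomials: its immediate successors
are the polynomials `T_d`, `d ∈ 𝒟_i`, in the order of the values `|d|`. -/
def TStep {R K : Type*} [CommRing R] [Field K] [Algebra R K] (v : AddValuation K (WithTop ℚ))
    (k : Type*) [Field k] [Algebra k K] [Algebra k R] (P T : ℕ → R) (i : ℕ) : Prop :=
  ∃ e : Fin (δ v P T i) ≃ D v P T i,
    (Monotone fun t => absVal v P T i (e t)) ∧
    ∀ t : Fin (δ v P T i), IsTd v k P T i (e t) (T (offset v P T i + (t + 1)))

omit [IsScalarTower k R K] in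
lemma TStep.exists_isTd {i : ℕ} (h : TStep v k P T i) {d : Mon × ℕ} (hd : d ∈ D v P T i) :
    ∃ j, 0 < j ∧ IsTd v k P T i d (T j) := by
  obtain ⟨e, -, he⟩ := h
  refine ⟨_, ?_, by simpa using he (e.symm ⟨d, hd⟩)⟩
  omega

lemma isIrred_zero (hβ : 0 < val v (P 0)) (i : ℕ) : IsIrred (calT v P T i) 0 := by
  intro N hN hmem
  obtain rfl : N = 0 := le_antisymm hN (zero_le)
  rcases mem_calT.1 hmem with ⟨j, -, h⟩ | ⟨l, -, -, -, h⟩ | ⟨l, -, -, d, hd, h⟩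
  · have := DFunLike.congr_fun h (Sum.inl j)
    simp [(q_pos hβ j).ne] at this
  · have := DFunLike.congr_fun h (Sum.inr l)
    simp at this
  · have := DFunLike.congr_fun h (Sum.inr l)
    rw [leadMon_apply_inr hd] at this
    exact (Nat.mul_pos hd.2.2.1 (s_pos hβ l)).ne this

lemma s_eq_one {i a : ℕ} (h : val v (T i) ∈ S v P a ⊔ U v T (i - 1)) : s v P T i = 1 :=
  leastMultiple_eq_one (S_sup_U_le _ _ h)

/-- If the value of `T_i` is a value of a monomial in the previous variables, then `𝒟_i` consists of
the exponent vector of `T_i`. -/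
lemma D_eq_singleton (hβ : 0 < val v (P 0)) {i : ℕ} (hT : T i ≠ 0)
    (h : val v (T i) ∈ S v P (m v P T i) ⊔ U v T (i - 1)) : D v P T i = {(0, 1)} := by
  have hs := s_eq_one h
  ext ⟨a, c⟩
  rw [Set.mem_singleton_iff, Prod.mk.injEq]
  constructor
  · rintro ⟨-, -, hc, hred, -⟩
    simp only at hc hred
    have h1 : ¬ (0 : Mon).degree + 1 < a.degree + c := fun hlt =>
      hred.2 0 1 (zero_le) one_pos hc hlt (by simpa [hs] using h)
    rw [map_zero] at h1
    exact ⟨(Finsupp.degree_eq_zero_iff a).1 (by omega), by omega⟩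
  · rintro ⟨rfl, rfl⟩
    refine ⟨hT, by simp, one_pos, ⟨by simpa [hs] using h, ?_⟩, isIrred_zero hβ i⟩
    intro b e _ he _ hlt
    rw [map_zero] at hlt
    omega

lemma IsRedundant.single_mem_calT (hβ : 0 < val v (P 0)) {j : ℕ} (h : IsRedundant v P T j) :
    Finsupp.single (Sum.inr j) 1 ∈ calT v P T (j + 1) := by
  by_cases h0 : T j = 0
  · have hj : 0 < j := by cases h <;> assumption
    exact mem_calT.2 (Or.inr (Or.inl ⟨j, hj, j.lt_succ_self, h0, rfl⟩))
  · cases h with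
    | of_eq_zero _ _ h => exact absurd h h0
    | of_successor _ hj hdep _ _ =>
      refine mem_calT.2 (Or.inr (Or.inr ⟨j, hj, j.lt_succ_self, (0, 1), ?_, ?_⟩))
      · rw [D_eq_singleton hβ h0 hdep]
        rfl
      · simp [leadMon, s_eq_one hdep]

variable (v P T) in
/-- The monomials in the `P_j` and the `T_j` that are not redundant. -/
def nonredundantSet : Set Mon :=
  {M | ∀ j, Sum.inr j ∈ M.support → 0 < j ∧ ¬ IsRedundant v P T j}

variable (k v P T) in
/-- The `k`-linear span of the monomials of value at least `τ` in the `P_j` and the nonredundant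
`T_j`. -/
def nonredundantSpan (τ : WithTop ℚ) : Submodule k R :=
  Submodule.span k {f | ∃ M ∈ nonredundantSet v P T, f = evalMon P T M ∧ τ ≤ v (algebraMap R K f)}

omit [Algebra k K] [IsScalarTower k R K] in
lemma nonredundantSpan_anti {τ τ' : WithTop ℚ} (h : τ ≤ τ') :
    nonredundantSpan k v P T τ' ≤ nonredundantSpan k v P T τ := by
  refine Submodule.span_mono ?_
  rintro f ⟨M, hM, hf, hτ⟩
  exact ⟨M, hM, hf, h.trans hτ⟩

omit [Algebra k K] [IsScalarTower k R K] in
lemma mul_mem_nonredundantSpan {τ τ' : WithTop ℚ} {f g : R} (hf : f ∈ nonredundantSpan k v P T τ)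
    (hg : g ∈ nonredundantSpan k v P T τ') : f * g ∈ nonredundantSpan k v P T (τ + τ') := by
  classical
  have := Submodule.mul_mem_mul hf hg
  rw [nonredundantSpan, nonredundantSpan, Submodule.span_mul_span] at this
  refine Submodule.span_mono ?_ this
  rintro _ ⟨_, ⟨M, hM, rfl, hτ⟩, _, ⟨N, hN, rfl, hτ'⟩, rfl⟩
  refine ⟨M + N, fun j hj => ?_, (evalMon_add M N).symm, ?_⟩
  · rcases Finset.mem_union.1 (Finsupp.support_add hj) with h | h
    exacts [hM j h, hN j h]
  · rw [map_mul, AddValuation.map_mul]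
    exact add_le_add hτ hτ'

omit [Algebra k K] [IsScalarTower k R K] in
lemma one_mem_nonredundantSpan : (1 : R) ∈ nonredundantSpan k v P T 0 :=
  Submodule.subset_span ⟨0, fun j hj => by simp at hj, by simp, by simp⟩

omit [Algebra k K] [IsScalarTower k R K] in
lemma pow_mem_nonredundantSpan {τ : WithTop ℚ} {f : R} (hf : f ∈ nonredundantSpan k v P T τ)
    (n : ℕ) : f ^ n ∈ nonredundantSpan k v P T (n • τ) := by
  induction n with
  | zero => simpa using one_mem_nonredundantSpan
  | succ n ih =>
    rw [pow_succ, succ_nsmul]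
    exact mul_mem_nonredundantSpan ih hf

variable (hv : IsRational k R v) (hβ : 0 < val v (P 0)) (hT : ∀ i, 0 < i → TStep v k P T i)
include hv hβ hT

/-- A redundant `T_i` is a combination of monomials of at least the same value in nonredundant
variables: `T_i = μ N + T_j` with `T_j` its immediate successor, and the irreducible monomial `N`
does not contain redundant variables, since these are themselves reducible. -/
lemma IsRedundant.mem_nonredundantSpan {i : ℕ} (h : IsRedundant v P T i) :
    T i ∈ nonredundantSpan k v P T (v (algebraMap R K (T i))) := by
  induction h with
  | of_eq_zero i _ h =>
    rw [h]
    exact zero_mem _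
  | of_successor i hi hdep _ _ ih =>
    by_cases h0 : T i = 0
    · rw [h0]
      exact zero_mem _
    have hD := D_eq_singleton hβ h0 hdep
    have hδ : δ v P T i = 1 := by rw [δ, if_neg hi.ne', hD, Set.ncard_singleton]
    have hoff : offset v P T (i + 1) = offset v P T i + 1 := by
      rw [offset, Finset.sum_range_succ, hδ, offset]
    obtain ⟨e, -, he⟩ := hT i hi
    have h01 : (e ⟨0, by omega⟩ : Mon × ℕ) = (0, 1) := by
      rw [← Set.mem_singleton_iff, ← hD]
      exact (e ⟨0, by omega⟩).2
    have htd := he ⟨0, by omega⟩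
    rw [h01] at htd
    obtain ⟨N, c, hN, hw, hirr, hres, heq⟩ := htd
    have hlead : evalMon P T (leadMon v P T i (0, 1)) = T i := by
      simp [leadMon, s_eq_one hdep]
    rw [hlead] at hres heq
    simp only [zero_add] at heq
    rw [← hoff] at heq
    have hN0 : evalMon P T N ≠ 0 := hirr.evalMon_ne_zero_of_vars hv hβ hN
    have hvN : v (algebraMap R K (evalMon P T N)) = v (algebraMap R K (T i)) := by
      rw [v_evalMon hv hN0, ← hw, coe_val hv h0, absVal, leadMon]
      simp [s_eq_one hdep]
    have hlt := lt_sub_of_isResidue hv hN0 hres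
    rw [← heq, hvN] at hlt
    have hTi : T i = T (offset v P T (i + 1)) + c • evalMon P T N := by
      rw [heq, Algebra.smul_def]
      ring
    have hmem : evalMon P T N ∈ nonredundantSpan k v P T (v (algebraMap R K (T i))) := by
      refine Submodule.subset_span ⟨N, fun j hj => ?_, rfl, hvN.ge⟩
      rcases hN hj with ⟨l, -, hl⟩ | ⟨l, hl0, hl, hl'⟩
      · cases hl
      · cases hl'
        refine ⟨hl0, fun hred => hirr _ ?_ (calT_mono hl (hred.single_mem_calT hβ))⟩
        exact Finsupp.single_le_iff.2
          (Nat.one_le_iff_ne_zero.2 (Finsupp.mem_support_iff.1 hj))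
    have := add_mem (nonredundantSpan_anti hlt.le ih) (Submodule.smul_mem _ c hmem)
    rwa [← hTi] at this

lemma evalMon_mem_nonredundantSpan {M : Mon} (hM : M (Sum.inr 0) = 0) :
    evalMon P T M ∈ nonredundantSpan k v P T (v (algebraMap R K (evalMon P T M))) := by
  have hvar : ∀ x : Var, x ≠ Sum.inr 0 →
      Sum.elim P T x ∈ nonredundantSpan k v P T (v (algebraMap R K (Sum.elim P T x))) := by
    intro x hx
    by_cases hred : ∃ j, x = Sum.inr j ∧ IsRedundant v P T j
    · obtain ⟨j, rfl, hj⟩ := hred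
      exact hj.mem_nonredundantSpan hv hβ hT
    · refine Submodule.subset_span ⟨Finsupp.single x 1, fun j hj => ?_, by simp, le_rfl⟩
      obtain rfl := Finset.mem_singleton.1 (Finsupp.support_single_subset hj)
      refine ⟨Nat.pos_of_ne_zero ?_, fun h => hred ⟨j, rfl, h⟩⟩
      rintro rfl
      exact hx rfl
  induction M using Finsupp.induction with
  | zero => simpa using one_mem_nonredundantSpan
  | single_add x n M hxM hn ih =>
    have hx : x ≠ Sum.inr 0 := by
      rintro rfl
      simp [hn] at hM
    have hM' : M (Sum.inr 0) = 0 := by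
      simp only [Finsupp.add_apply] at hM
      omega
    rw [evalMon_add, evalMon_single, map_mul, AddValuation.map_mul, map_pow,
      AddValuation.map_pow]
    exact mul_mem_nonredundantSpan (pow_mem_nonredundantSpan (hvar x hx) n) (ih hM')

omit hv hβ hT in
lemma exists_eq_prod_reducedSequence {M : Mon} (hM : M ∈ nonredundantSet v P T) :
    ∃ b : ReducedIndex v P T →₀ ℕ,
      evalMon P T M = b.prod fun i n => reducedSequence v P T i ^ n := by
  set φ : ReducedIndex v P T → Var := Sum.map id Subtype.val with hφ
  have hinj : Function.Injective φ := Sum.map_injective.2 ⟨fun _ _ h => h, Subtype.val_injective⟩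
  refine ⟨M.comapDomain φ hinj.injOn, ?_⟩
  have hrange : (M.support : Set Var) ⊆ Set.range φ := by
    rintro (j | j) hj
    · exact ⟨Sum.inl j, rfl⟩
    · exact ⟨Sum.inr ⟨j, hM j hj⟩, rfl⟩
  conv_lhs => rw [← Finsupp.mapDomain_comapDomain φ hinj M hrange]
  rw [evalMon, Finsupp.prod_mapDomain_index_inj hinj]
  refine Finsupp.prod_congr fun x _ => ?_
  rcases x with j | j <;> rfl

/-- The nonredundant jumping polynomials form a generating sequence. -/
theorem isGeneratingSequence_reducedSequence [IsLocalRing R] [IsNoetherianRing R]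
    (hP : ∀ i, 0 < i → PStep v k P T i)
    (hdom : ∀ f : R, f ∈ IsLocalRing.maximalIdeal R ↔ 0 < v (algebraMap R K f))
    (hm : IsLocalRing.maximalIdeal R = Ideal.span {P 0, P 1, T 1}) :
    IsGeneratingSequence v (reducedSequence v P T) := by
  intro σ _
  set J := Ideal.span {f : R | ∃ b : ReducedIndex v P T →₀ ℕ,
    f = b.prod (fun i n => reducedSequence v P T i ^ n) ∧
      (σ : WithTop ℚ) ≤ v (algebraMap R K f)} with hJ
  have hle : nonredundantSpan k v P T σ ≤ J.restrictScalars k := by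
    refine Submodule.span_le.2 ?_
    rintro _ ⟨M, hM, rfl, hσ⟩
    obtain ⟨b, hb⟩ := exists_eq_prod_reducedSequence hM
    exact Ideal.subset_span ⟨b, hb, hσ⟩
  refine Set.Subset.antisymm ?_ ?_
  · intro f hf
    have h1 : f ∈ monIdeal v P T σ :=
      valIdeal_le_monIdeal hv hβ hP (fun l hl _ hd => (hT l hl).exists_isTd hd) hdom hm σ hf
    refine (Ideal.span_le.2 ?_ : monIdeal v P T σ ≤ J) h1
    rintro _ ⟨M, hM, rfl, hσ⟩
    exact hle (nonredundantSpan_anti hσ (evalMon_mem_nonredundantSpan hv hβ hT hM))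
  · refine (Ideal.span_le.2 ?_ : J ≤ valIdeal hv σ)
    rintro _ ⟨b, -, hσ⟩
    exact hσ

end Redundant

/-! ### Dependence of the construction on initial segments -/

section Congr

variable {k R K : Type*} [Field k] [CommRing R] [Field K] [Algebra k K] [Algebra k R]
  [Algebra R K] {v : AddValuation K (WithTop ℚ)} {P P' T T' : ℕ → R}

lemma offset_succ (i : ℕ) : offset v P T (i + 1) = offset v P T i + δ v P T i :=
  Finset.sum_range_succ _ _

lemma G_congr {i : ℕ} (h : ∀ j ≤ i, P j = P' j) : G v P i = G v P' i := by
  unfold G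
  exact congrArg _ (Set.image_congr fun j hj => by rw [h j hj])

lemma q_congr {i : ℕ} (h : ∀ j ≤ i, P j = P' j) : q v P i = q v P' i := by
  rw [q_eq, q_eq, h i le_rfl, G_congr fun j hj => h j (by omega)]

lemma calP_congr {i : ℕ} (h : ∀ j ≤ i, P j = P' j) : calP v P i = calP v P' i := by
  ext M
  refine exists_congr fun j => and_congr_right fun _ => and_congr_right fun hj => ?_
  rw [q_congr fun l hl => h l (by omega)]

lemma PStep.congr {i : ℕ} (hP : PStep v k P T i) (h : ∀ j ≤ i + 1, P j = P' j) :
    PStep v k P' T' i := by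
  obtain ⟨N, c, hN, hw, hirr, hres, heq⟩ := hP
  have hx : ∀ x ∈ N.support, Sum.elim P T x = Sum.elim P' T' x := fun x hx => by
    obtain ⟨j, hj, rfl⟩ := hN x hx
    exact h j (by omega)
  have he := evalMon_congr hx
  have hq : q v P i = q v P' i := q_congr fun j hj => h j (by omega)
  have hi := h i (by omega)
  refine ⟨N, c, hN, ?_, ?_, ?_, ?_⟩
  · rw [← hq, ← hi, hw]
    exact weight_congr fun x hx' => by rw [varVal_apply, varVal_apply, hx x hx']
  · rwa [← calP_congr fun j hj => h j (by omega)]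
  · rwa [← hq, ← hi, ← he]
  · rw [← h (i + 1) le_rfl, ← hi, ← hq, ← he, heq]

lemma H_congr {i : ℕ} (h : ∀ j ≤ i, T j = T' j) : H v T i = H v T' i := by
  unfold H
  exact congrArg _ (Set.image_congr fun j hj => by rw [h j hj.2])

lemma U_congr {i : ℕ} (h : ∀ j ≤ i, T j = T' j) : U v T i = U v T' i := by
  unfold U
  exact congrArg _ (Set.image_congr fun j hj => by rw [h j hj.2])

lemma s_congr {i : ℕ} (h : ∀ j ≤ i, T j = T' j) : s v P T i = s v P T' i := by
  rw [s_eq, s_eq, h i le_rfl, H_congr fun j hj => h j (by omega)]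

lemma m_congr {i : ℕ} (h : ∀ j ≤ i, T j = T' j) : m v P T i = m v P T' i := by
  induction i with
  | zero => rfl
  | succ i ih =>
    rw [m, m, ih fun j hj => h j (by omega), s_congr h, h (i + 1) le_rfl,
      H_congr fun j hj => h j (by omega)]

omit [CommRing R] in
lemma elim_congr {i a : ℕ} (h : ∀ j ≤ i, T j = T' j) {M : Mon} (hM : ↑M.support ⊆ vars a i) :
    ∀ x ∈ M.support, Sum.elim P T x = Sum.elim P T' x := fun x hx => by
  rcases hM hx with ⟨j, -, rfl⟩ | ⟨j, -, hj, rfl⟩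
  exacts [rfl, h j hj.le]

lemma varVal_congr {i a : ℕ} (h : ∀ j ≤ i, T j = T' j) {M : Mon} (hM : ↑M.support ⊆ vars a i) :
    ∀ x ∈ M.support, varVal v P T x = varVal v P T' x := fun x hx => by
  rw [varVal_apply, varVal_apply, elim_congr h hM x hx]

lemma IsReduced.congr {ι : Type*} {Φ : AddSubmonoid ℚ} {w w' : ι → ℚ} {μ : ℚ} {a : ι →₀ ℕ} {c : ℕ}
    (hred : IsReduced Φ w μ a c) (h : ∀ x ∈ a.support, w x = w' x) : IsReduced Φ w' μ a c := by
  refine ⟨weight_congr h ▸ hred.1, fun b e hb he hec hlt => ?_⟩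
  rw [← weight_congr fun x hx => h x (Finsupp.support_mono hb hx)]
  exact hred.2 b e hb he hec hlt

lemma DSet_subset {i : ℕ} (h : ∀ j ≤ i, T j = T' j) (X : Set Mon) :
    DSet v P T X i ⊆ DSet v P T' X i := by
  rintro d ⟨h0, hs, hd, hred, hirr⟩
  refine ⟨h i le_rfl ▸ h0, m_congr (v := v) (P := P) h ▸ hs, hd, ?_, hirr⟩
  rw [← m_congr h, ← s_congr h, ← h i le_rfl, ← U_congr fun j hj => h j (by omega)]
  exact hred.congr (varVal_congr h hs)

lemma DSet_congr {i : ℕ} (h : ∀ j ≤ i, T j = T' j) (X : Set Mon) :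
    DSet v P T X i = DSet v P T' X i :=
  (DSet_subset h X).antisymm (DSet_subset (fun j hj => (h j hj).symm) X)

lemma leadMon_congr {i : ℕ} (h : ∀ j ≤ i, T j = T' j) (d : Mon × ℕ) :
    leadMon v P T i d = leadMon v P T' i d := by rw [leadMon, leadMon, s_congr h]

lemma calT_congr {i : ℕ} (h : ∀ j < i, T j = T' j) : calT v P T i = calT v P T' i := by
  induction i with
  | zero => rfl
  | succ i ih =>
    cases i with
    | zero => rfl
    | succ i =>
      have h' : ∀ j ≤ i + 1, T j = T' j := fun j hj => h j (by omega)
      rw [calT, calT, ih fun j hj => h j (by omega), h (i + 1) (by omega), DSet_congr h',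
        funext (leadMon_congr h')]

lemma D_congr {i : ℕ} (h : ∀ j ≤ i, T j = T' j) : D v P T i = D v P T' i := by
  rw [D, D, calT_congr fun j hj => h j hj.le, DSet_congr h]

lemma δ_congr {i : ℕ} (h : ∀ j ≤ i, T j = T' j) : δ v P T i = δ v P T' i := by
  rw [δ, δ, D_congr h]

lemma offset_congr {i : ℕ} (h : ∀ j < i, T j = T' j) : offset v P T i = offset v P T' i :=
  Finset.sum_congr rfl fun _ hj => δ_congr fun l hl =>
    h l (hl.trans_lt (Finset.mem_range.1 hj))

lemma elim_leadMon_congr {i : ℕ} (h : ∀ j ≤ i, T j = T' j) {d : Mon × ℕ} (hd : d ∈ D v P T i) :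
    ∀ x ∈ (leadMon v P T i d).support, Sum.elim P T x = Sum.elim P T' x := fun x hx => by
  classical
  rcases Finset.mem_union.1 (Finsupp.support_add hx) with hx | hx
  · exact elim_congr h hd.2.1 x hx
  · rw [Finset.mem_singleton.1 (Finsupp.support_single_subset hx)]
    exact h i le_rfl

lemma absVal_congr {i : ℕ} (h : ∀ j ≤ i, T j = T' j) {d : Mon × ℕ} (hd : d ∈ D v P T i) :
    absVal v P T i d = absVal v P T' i d := by
  rw [absVal, absVal, ← leadMon_congr h]
  exact weight_congr fun x hx => by
    rw [varVal_apply, varVal_apply, elim_leadMon_congr h hd x hx]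

lemma IsTd.congr {i : ℕ} (h : ∀ j ≤ i, T j = T' j) {d : Mon × ℕ} (hd : d ∈ D v P T i) {f : R}
    (hf : IsTd v k P T i d f) : IsTd v k P T' i d f := by
  obtain ⟨N, c, hN, hw, hirr, hres, rfl⟩ := hf
  have he := evalMon_congr (elim_congr (P := P) h hN)
  have hl : evalMon P T (leadMon v P T i d) = evalMon P T' (leadMon v P T' i d) := by
    rw [← leadMon_congr h, evalMon_congr (elim_leadMon_congr h hd)]
  refine ⟨N, c, ?_, ?_, ?_, ?_, by rw [he, hl]⟩
  · rwa [← m_congr h]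
  · rw [← absVal_congr h hd, hw]
    exact weight_congr (varVal_congr h hN)
  · rwa [← calT_congr fun j hj => h j hj.le]
  · rwa [← he, ← hl]

/-- The condition on `T_i`, when the first part of the sequence and the successors of `T_i` come
from different sequences. -/
lemma TStep.of_isTd {i : ℕ} (h : ∀ j ≤ i, T j = T' j) (e : Fin (δ v P T i) ≃ D v P T i)
    (hmono : Monotone fun t => absVal v P T i (e t))
    (he : ∀ t : Fin (δ v P T i), IsTd v k P T i (e t) (T' (offset v P T i + (t + 1)))) :
    TStep v k P T' i := by
  have hoff := offset_congr (v := v) (P := P) fun j hj => h j (le_of_lt (α := ℕ) hj)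
  refine ⟨(finCongr (δ_congr h)).symm.trans (e.trans (Equiv.setCongr (D_congr h))), ?_, ?_⟩
  · intro a b hab
    have h1 := absVal_congr h (e ((finCongr (δ_congr h)).symm a)).2
    have h2 := absVal_congr h (e ((finCongr (δ_congr h)).symm b)).2
    have h3 : absVal v P T i _ ≤ absVal v P T i _ :=
      hmono (a := (finCongr (δ_congr h)).symm a) (b := (finCongr (δ_congr h)).symm b) hab
    rw [h1, h2] at h3
    exact h3
  · intro t
    have h1 := (he ((finCongr (δ_congr h)).symm t)).congr h (e _).2
    rw [← hoff]
    exact h1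

lemma TStep.congr {i : ℕ} (hT : TStep v k P T i) (h : ∀ j ≤ i, T j = T' j)
    (h' : ∀ j ≤ offset v P T (i + 1), T j = T' j) : TStep v k P T' i := by
  obtain ⟨e, hmono, he⟩ := hT
  refine TStep.of_isTd h e hmono fun t => ?_
  rw [← h' _ (by rw [offset_succ]; omega)]
  exact he t

end Congr

/-! ### Existence of jumping polynomials -/

section Existence

variable {k R K : Type*} [Field k] [CommRing R] [Field K] [Algebra k K] [Algebra k R]
  [Algebra R K] [IsScalarTower k R K] {v : AddValuation K (WithTop ℚ)} {P T : ℕ → R}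

omit [IsScalarTower k R K] in
lemma PStep.eq_zero (hv : IsRational k R v) {j : ℕ} (hP : PStep v k P T j)
    (h0 : P j = 0) : P (j + 1) = 0 := by
  obtain ⟨N, c, hN, hw, hirr, hres, heq⟩ := hP
  have hc : c = 0 := by
    by_contra hc
    have hres' : 0 < v (algebraMap R K (P j ^ q v P j) / algebraMap R K (evalMon P T N) -
      algebraMap k K c) := hres
    rw [q_eq_one h0, h0] at hres'
    simp [AddValuation.map_neg, hv.map_const c hc] at hres'
  rw [heq, h0, q_eq_one h0, hc]
  simp

lemma PStep.q_mul_val_le (hv : IsRational k R v) (hβ : 0 < val v (P 0)) {j : ℕ}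
    (hP : PStep v k P T j) (h0 : P (j + 1) ≠ 0) :
    (q v P j : ℚ) * val v (P j) ≤ val v (P (j + 1)) := by
  obtain ⟨N, c, hN, hw, hirr, hres, heq⟩ := hP
  have hN0 : evalMon P T N ≠ 0 := evalMon_ne_zero hv fun x hx => by
    obtain ⟨l, hl, rfl⟩ := hN x hx
    exact hirr.P_ne_zero (fun h0 => by simp [h0] at hβ) hl hx
  have := lt_sub_of_isResidue hv hN0 hres
  rw [← heq, v_evalMon hv hN0, coe_val hv h0, ← hw] at this
  exact (WithTop.coe_lt_coe.1 this).le

lemma G_succ_le (n : ℕ) :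
    G v P (n + 1) ≤ G v P n ⊔ AddSubgroup.zmultiples (val v (P (n + 1))) := by
  refine (AddSubgroup.closure_le _).2 ?_
  rintro _ ⟨j, hj, rfl⟩
  rcases Nat.lt_or_ge j (n + 1) with h | h
  · exact (le_sup_left : G v P n ≤ _) (val_mem_G (by omega))
  · obtain rfl : j = n + 1 := le_antisymm hj h
    exact (le_sup_right : _ ≤ G v P n ⊔ AddSubgroup.zmultiples (val v (P (n + 1))))
      (AddSubgroup.mem_zmultiples _)

/-- Every element of `G_n` is the value of a monomial in `P_1, …, P_n` with exponents less than
`q_j`, plus an integral multiple of `β_0`; the value of the monomial is at most `β_{n+1}`, because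
`q_j β_j ≤ β_{j+1}`. -/
lemma exists_normal_form (hv : IsRational k R v) (hβ : 0 < val v (P 0)) (n : ℕ)
    (hP : ∀ j, 0 < j → j ≤ n → PStep v k P T j) (h0 : P (n + 1) ≠ 0) {g : ℚ} (hg : g ∈ G v P n) :
    ∃ (N : Mon) (z : ℤ), (∀ x ∈ N.support, ∃ j, 0 < j ∧ j ≤ n ∧ x = Sum.inl j) ∧
      (∀ j, 0 < j → N (Sum.inl j) < q v P j) ∧
      weight (varVal v P T) N ≤ val v (P (n + 1)) ∧
      g = weight (varVal v P T) N + z * val v (P 0) := by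
  induction n generalizing g with
  | zero =>
    have hG : G v P 0 ≤ AddSubgroup.zmultiples (val v (P 0)) := by
      refine (AddSubgroup.closure_le _).2 ?_
      rintro _ ⟨j, hj, rfl⟩
      obtain rfl : j = 0 := Nat.le_zero.1 hj
      exact AddSubgroup.mem_zmultiples _
    obtain ⟨z, rfl⟩ := AddSubgroup.mem_zmultiples_iff.1 (hG hg)
    exact ⟨0, z, by simp, fun j _ => q_pos hβ j, by simpa using val_nonneg hv _, by simp⟩
  | succ n ih =>
    have hne : P (n + 1) ≠ 0 := fun h => h0 ((hP (n + 1) (by omega) le_rfl).eq_zero hv h)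
    obtain ⟨a, ha, b, hb, rfl⟩ := AddSubgroup.mem_sup.1 (G_succ_le n hg)
    obtain ⟨y, rfl⟩ := AddSubgroup.mem_zmultiples_iff.1 hb
    set Q := q v P (n + 1) with hQ
    have hQpos : 0 < Q := q_pos hβ _
    obtain ⟨r, hr⟩ := Int.eq_ofNat_of_zero_le (Int.emod_nonneg y (b := Q) (by omega))
    have hrlt : r < Q := by
      have := Int.emod_lt_of_pos y (b := Q) (by omega)
      omega
    have hy : (y : ℚ) = Q * (y / Q : ℤ) + r := by
      have := Int.mul_ediv_add_emod y Q
      rw [hr] at this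
      exact_mod_cast this.symm
    obtain ⟨N, z, hN, hq, hw, heq⟩ := ih (fun j hj hjn => hP j hj (by omega)) hne
      (add_mem ha (zsmul_mem (q_mul_mem hβ (n + 1)) (y / Q)))
    have hN0 : N (Sum.inl (n + 1)) = 0 := by
      by_contra h
      obtain ⟨j, -, hj, hj'⟩ := hN _ (Finsupp.mem_support_iff.2 h)
      cases hj'
      omega
    refine ⟨N + Finsupp.single (Sum.inl (n + 1)) r, z, ?_, ?_, ?_, ?_⟩
    · classical
      intro x hx
      rcases Finset.mem_union.1 (Finsupp.support_add hx) with h | h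
      · obtain ⟨j, hj, hjn, rfl⟩ := hN x h
        exact ⟨j, hj, by omega, rfl⟩
      · exact ⟨n + 1, by omega, le_rfl, Finset.mem_singleton.1 (Finsupp.support_single_subset h)⟩
    · intro j hj
      by_cases hjn : j = n + 1
      · subst hjn
        simpa [hN0] using hrlt
      · have := hq j hj
        rwa [Finsupp.add_apply, Finsupp.single_eq_of_ne (by simpa using hjn), add_zero]
    · have h1 := (hP (n + 1) (by omega) le_rfl).q_mul_val_le hv hβ h0
      have h2 : ((r : ℚ) + 1) * val v (P (n + 1)) ≤ Q * val v (P (n + 1)) :=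
        mul_le_mul_of_nonneg_right (by exact_mod_cast hrlt) (val_nonneg hv _)
      rw [weight_add, weight_single, varVal_inl]
      linarith
    · rw [weight_add, weight_single, varVal_inl, zsmul_eq_mul, hy]
      rw [zsmul_eq_mul] at heq
      linear_combination heq

/-- The next polynomial `P_{i+1}` can be constructed. -/
lemma exists_PStep (hv : IsRational k R v) (hβ : 0 < val v (P 0)) {i : ℕ} (hi : 0 < i)
    (hP : ∀ j, 0 < j → j < i → PStep v k P T j) :
    ∃ f, PStep v k (Function.update P (i + 1) f) T i := by
  have hP0 : P 0 ≠ 0 := fun h => by simp [h] at hβ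
  obtain ⟨N, c, hN, hw, hirr, hres⟩ : ∃ (N : Mon) (c : k),
      (∀ x ∈ N.support, ∃ j < i, x = Sum.inl j) ∧
      (q v P i : ℚ) * val v (P i) = weight (varVal v P T) N ∧
      IsIrred (calP v P i) N ∧ IsResidue v (P i ^ q v P i) (evalMon P T N) c := by
    have hcalP : ∀ N : Mon, (∀ j, 0 < j → N (Sum.inl j) < q v P j) → IsIrred (calP v P i) N := by
      rintro N hN _ hle ⟨j, hj, -, rfl⟩
      exact (hN j hj).not_ge (Finsupp.single_le_iff.1 hle)
    by_cases h0 : P i = 0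
    · exact ⟨0, 0, by simp, by simp [h0], hcalP _ fun j _ => q_pos hβ j, by
        simp [IsResidue, h0, q_eq_one h0]⟩
    · obtain ⟨n, rfl⟩ : ∃ n, i = n + 1 := ⟨i - 1, by omega⟩
      obtain ⟨N, z, hN, hq, hw, heq⟩ := exists_normal_form hv hβ n
        (fun j hj hjn => hP j hj (by omega)) h0 (q_mul_mem hβ (n + 1))
      have hz : 0 ≤ z := by
        have h1 : (1 : ℚ) * val v (P (n + 1)) ≤ q v P (n + 1) * val v (P (n + 1)) :=
          mul_le_mul_of_nonneg_right (by exact_mod_cast q_pos hβ (n + 1)) (val_nonneg hv _)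
        have h2 : 0 ≤ (z : ℚ) * val v (P 0) := by linarith
        exact_mod_cast nonneg_of_mul_nonneg_left h2 hβ
      obtain ⟨a, rfl⟩ := Int.eq_ofNat_of_zero_le hz
      have hsupp : ∀ x ∈ (N + Finsupp.single (Sum.inl 0) a : Mon).support,
          ∃ j < n + 1, x = Sum.inl j := by
        classical
        intro x hx
        rcases Finset.mem_union.1 (Finsupp.support_add hx) with h | h
        · obtain ⟨j, hj, hjn, rfl⟩ := hN x h
          exact ⟨j, by omega, rfl⟩
        · exact ⟨0, by omega, Finset.mem_singleton.1 (Finsupp.support_single_subset h)⟩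
      have hirr : IsIrred (calP v P (n + 1)) (N + Finsupp.single (Sum.inl 0) a) :=
        hcalP _ fun j hj => by
          have := hq j hj
          rwa [Finsupp.add_apply, Finsupp.single_eq_of_ne (by simpa using hj.ne'), add_zero]
      have hw' : (q v P (n + 1) : ℚ) * val v (P (n + 1)) =
          weight (varVal v P T) (N + Finsupp.single (Sum.inl 0) a) := by
        rw [weight_add, weight_single, varVal_inl, heq]
        simp
      have hne : evalMon P T (N + Finsupp.single (Sum.inl 0) a) ≠ 0 :=
        evalMon_ne_zero hv fun x hx => by
          obtain ⟨j, hj, rfl⟩ := hsupp x hx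
          exact hirr.P_ne_zero hP0 hj hx
      obtain ⟨c, hc⟩ : ∃ c : k, IsResidue v (P (n + 1) ^ q v P (n + 1))
          (evalMon P T (N + Finsupp.single (Sum.inl 0) a)) c := by
        refine exists_isResidue hv hne ?_
        rw [v_evalMon hv hne, ← hw', map_pow, AddValuation.map_pow, coe_val hv h0, ← nsmul_eq_mul]
        rfl
      exact ⟨_, c, hsupp, hw', hirr, hc⟩
  set f := P i ^ q v P i - algebraMap k R c * evalMon P T N with hf
  have hP' : ∀ j ≤ i, P j = Function.update P (i + 1) f j := fun j hj =>
    (Function.update_of_ne (by omega) _ _).symm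
  have hx : ∀ x ∈ N.support, Sum.elim P T x = Sum.elim (Function.update P (i + 1) f) T x := by
    intro x hx
    obtain ⟨j, hj, rfl⟩ := hN x hx
    exact hP' j hj.le
  refine ⟨f, N, c, hN, ?_, ?_, ?_, ?_⟩
  · rw [← q_congr hP', ← hP' i le_rfl, hw]
    exact weight_congr fun x hx' => by rw [varVal_apply, varVal_apply, hx x hx']
  · rwa [← calP_congr hP']
  · rwa [← q_congr hP', ← hP' i le_rfl, ← evalMon_congr hx]
  · rw [Function.update_self, ← q_congr hP', ← hP' i le_rfl, ← evalMon_congr hx]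

/-- Construction of a sequence in stages, where the stage `n + 1` does not change the terms of index
at most `n + 1`. -/
lemma exists_limit {α : Type*} (A : ℕ → (ℕ → α) → Prop) (h0 : ∃ f, A 0 f)
    (hs : ∀ n f, A n f → ∃ g, A (n + 1) g ∧ ∀ j ≤ n + 1, g j = f j) :
    ∃ F : ℕ → α, ∀ n, ∃ f, A n f ∧ ∀ j ≤ n + 1, F j = f j := by
  choose g hg hgf using hs
  obtain ⟨f₀, hf₀⟩ := h0
  let stage : ∀ n, {f : ℕ → α // A n f} := fun n =>
    Nat.rec ⟨f₀, hf₀⟩ (fun n f => ⟨g n f.1 f.2, hg n f.1 f.2⟩) n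
  have hstep : ∀ n, ∀ j ≤ n + 1, (stage (n + 1)).1 j = (stage n).1 j := fun n =>
    hgf n (stage n).1 (stage n).2
  have hle : ∀ n, ∀ j ≤ n, (stage n).1 j = (stage j).1 j := by
    intro n j hj
    induction n, hj using Nat.le_induction with
    | base => rfl
    | succ n hjn ih => rw [hstep n j (by omega), ih]
  refine ⟨fun j => (stage j).1 j, fun n => ⟨(stage n).1, (stage n).2, fun j hj => ?_⟩⟩
  rcases Nat.lt_or_ge n j with h | h
  · obtain rfl : j = n + 1 := by omega
    exact hstep n (n + 1) le_rfl
  · exact (hle n j h).symm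

lemma exists_P (hv : IsRational k R v) {x : R} (hx : 0 < val v x) (y : R) (T : ℕ → R) :
    ∃ P : ℕ → R, P 0 = x ∧ P 1 = y ∧ ∀ i, 0 < i → PStep v k P T i := by
  obtain ⟨P, hP⟩ := exists_limit
    (fun n (P : ℕ → R) => P 0 = x ∧ P 1 = y ∧ ∀ i, 0 < i → i ≤ n → PStep v k P T i)
    ⟨fun j => if j = 0 then x else y, by simp, by simp, by omega⟩ (by
    rintro n P ⟨h0, h1, hP⟩
    obtain ⟨f, hf⟩ := exists_PStep (i := n + 1) hv (h0 ▸ hx) (by omega)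
      fun j hj hjn => hP j hj (by omega)
    have hupd : ∀ j ≤ n + 1, Function.update P (n + 1 + 1) f j = P j := fun j hj =>
      Function.update_of_ne (by omega) _ _
    refine ⟨_, ⟨by rw [hupd 0 (by omega), h0], by rw [hupd 1 (by omega), h1], ?_⟩, hupd⟩
    intro i hi hin
    rcases Nat.lt_or_ge n i with h | h
    · obtain rfl : i = n + 1 := by omega
      exact hf
    · exact (hP i hi h).congr fun j hj => (hupd j (by omega)).symm)
  obtain ⟨f, ⟨hf0, hf1, -⟩, hf⟩ := hP 0
  refine ⟨P, by rw [hf 0 (by omega), hf0], by rw [hf 1 (by omega), hf1], fun i hi => ?_⟩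
  obtain ⟨g, ⟨-, -, hg⟩, hPg⟩ := hP i
  exact (hg i hi le_rfl).congr fun j hj => (hPg j hj).symm

/-- The polynomials `T_d`, `d ∈ 𝒟_i`, can be constructed. -/
lemma exists_isTd (hv : IsRational k R v) (hβ : 0 < val v (P 0))
    (hP : ∀ i, 0 < i → PStep v k P T i) {i : ℕ} (hT : ∀ l, 0 < l → l < i → TStep v k P T l)
    {d : Mon × ℕ} (hd : d ∈ D v P T i) : ∃ f, IsTd v k P T i d f := by
  have hmem : absVal v P T i d ∈ S v P (m v P T i) ⊔ U v T (i - 1) := by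
    rw [absVal_eq]
    exact hd.2.2.2.1.1
  obtain ⟨N, hN, hw, hirr⟩ := exists_irred_of_mem hv hβ hP
    (fun l hl hli _ hd => (hT l hl hli).exists_isTd hd) hmem
  have hN0 : evalMon P T N ≠ 0 := hirr.evalMon_ne_zero_of_vars hv hβ hN
  obtain ⟨c, hc⟩ := exists_isResidue hv hN0
    (f := evalMon P T (leadMon v P T i d)) (by
      rw [v_evalMon hv hN0, hw, v_evalMon hv (evalMon_leadMon_ne_zero hv hβ hd)]
      rfl)
  exact ⟨_, N, c, hN, hw.symm, hirr, hc, rfl⟩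

/-- A finite set can be enumerated so that a given function is monotone. -/
lemma exists_equiv_fin_monotone {α : Type*} {s : Set α} (hs : s.Finite) (g : α → ℚ) {n : ℕ}
    (hn : n = s.ncard) : ∃ e : Fin n ≃ s, Monotone fun t => g (e t) := by
  have := hs.to_subtype
  let e₀ : Fin n ≃ s := (Finite.equivFinOfCardEq (by rw [hn, Nat.card_coe_set_eq])).symm
  exact ⟨(Tuple.sort fun t => g (e₀ t)).trans e₀, Tuple.monotone_sort fun t => g (e₀ t)⟩

lemma exists_T (hv : IsRational k R v) (hβ : 0 < val v (P 0))
    (hP : ∀ T : ℕ → R, ∀ i, 0 < i → PStep v k P T i) (z : R) :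
    ∃ T : ℕ → R, T 1 = z ∧ (∀ i, 0 < i → TStep v k P T i) ∧
      ∀ i, offset v P T i < i → T i = 0 := by
  have hoff0 : ∀ T : ℕ → R, offset v P T 0 = 0 := fun T => rfl
  have hδ0 : ∀ T : ℕ → R, δ v P T 0 = 1 := fun T => rfl
  obtain ⟨T, hT⟩ := exists_limit
    (fun n (T : ℕ → R) => T 1 = z ∧ (∀ i, 0 < i → i ≤ n → TStep v k P T i) ∧
      ∀ j, offset v P T (n + 1) < j → T j = 0)
    ⟨fun j => if j = 1 then z else 0, by simp, by omega, fun j hj => by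
      rw [offset_succ, hoff0, hδ0] at hj
      exact if_neg (by omega)⟩ (by
    rintro n T ⟨hz, hT, hzero⟩
    set i := n + 1 with hi
    have hδ : δ v P T i = (D v P T i).ncard := if_neg (by omega)
    obtain ⟨e, he⟩ := exists_equiv_fin_monotone (finite_D (v := v) (P := P) (T := T) i)
      (absVal v P T i) hδ
    choose f hf using fun t => exists_isTd hv hβ (hP T)
      (fun l hl hli => hT l hl (by omega)) (e t).2
    let T' : ℕ → R := fun j =>
      if h : j - (offset v P T i + 1) < δ v P T i ∧ offset v P T i < j then
        f ⟨j - (offset v P T i + 1), h.1⟩ else T j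
    have hT'off : ∀ j ≤ offset v P T i, T j = T' j := fun j hj => by
      simp only [T']
      rw [dif_neg (by omega)]
    have hT'f : ∀ t : Fin (δ v P T i), T' (offset v P T i + (t + 1)) = f t := fun t => by
      have h1 : offset v P T i + (t + 1) - (offset v P T i + 1) = t := by omega
      simp only [T']
      rw [dif_pos (by omega)]
      exact congrArg f (Fin.ext h1)
    -- only terms of index greater than `i` are changed
    have hT'i : ∀ j ≤ i, T j = T' j := by
      intro j hj
      rcases Nat.eq_zero_or_pos (δ v P T i) with h0 | h0
      · simp only [T']
        rw [dif_neg (by omega)]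
      · refine hT'off j ?_
        by_contra! hlt
        have hTi : T i ≠ 0 := (e ⟨0, h0⟩).2.1
        exact hTi (hzero i (by omega))
    have hoffi : offset v P T i = offset v P T' i := offset_congr fun j hj => hT'i j hj.le
    have hδi : δ v P T i = δ v P T' i := δ_congr hT'i
    refine ⟨T', ⟨?_, ?_, ?_⟩, fun j hj => (hT'i j hj).symm⟩
    · rw [← hT'i 1 (by omega), hz]
    · intro l hl hli
      rcases Nat.lt_or_ge n l with h | h
      · rw [show l = i by omega]
        refine TStep.of_isTd hT'i e he fun t => ?_
        rw [hT'f]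
        exact hf t
      · have hle : offset v P T (l + 1) ≤ offset v P T i :=
          Finset.sum_le_sum_of_subset (Finset.range_mono (by omega))
        exact (hT l hl h).congr (fun j hj => hT'i j (by omega)) fun j hj => hT'off j (by omega)
    · intro j hj
      rw [offset_succ, ← hoffi, ← hδi] at hj
      have h1 : T' j = T j := dif_neg (by omega)
      rw [h1]
      exact hzero j (by omega))
  refine ⟨T, ?_, fun i hi => ?_, fun i hi => ?_⟩
  · obtain ⟨f, ⟨hf, -⟩, hTf⟩ := hT 0
    rw [hTf 1 le_rfl, hf]
  · obtain ⟨f, ⟨-, hf, -⟩, hTf⟩ := hT (i + offset v P T (i + 1))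
    have h1 : offset v P T (i + 1) = offset v P f (i + 1) :=
      offset_congr fun j hj => hTf j (by omega)
    exact (hf i hi (by omega)).congr (fun j hj => (hTf j (by omega)).symm)
      fun j hj => (hTf j (by omega)).symm
  · obtain ⟨n, rfl⟩ : ∃ n, i = n + 1 := ⟨i - 1, by omega⟩
    obtain ⟨f, ⟨-, -, hf⟩, hTf⟩ := hT n
    rw [offset_congr fun j hj => hTf j (le_of_lt (α := ℕ) hj)] at hi
    rw [hTf _ le_rfl]
    exact hf _ hi

end Existence

end JumpingPolynomials

/-! ### Jumping polynomials form a generating sequence -/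

theorem proposition4p11
    {k K R : Type*} [Field k] [IsAlgClosed k]
    -- an algebraic function field of transcendence degree 3 over `k`
    [Field K] [Algebra k K] (hKfg : (⊤ : IntermediateField k K).FG) (hKtr : Algebra.trdeg k K = 3)
    -- a regular local ring with regular parameters `x, y, z`, fraction field `K`, containing `k`
    [CommRing R] [IsRegularLocalRing R] [Algebra k R] [Algebra R K] [IsScalarTower k R K]
    [IsFractionRing R K]
    (x y z : R) (hdim : ringKrullDim R = 3)
    (hxyz : IsLocalRing.maximalIdeal R = Ideal.span {x, y, z})
    -- a valuation with values in `ℚ`, trivial on `k`, with residue field `k`, dominating `R`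
    (v : AddValuation K (WithTop ℚ))
    (hvk : ∀ c : k, c ≠ 0 → v (algebraMap k K c) = 0)
    (hvres : ∀ f : K, 0 ≤ v f → ∃ c : k, 0 < v (f - algebraMap k K c))
    (hvR : ∀ f : R, 0 ≤ v (algebraMap R K f))
    (hvdom : ∀ f : R, f ∈ IsLocalRing.maximalIdeal R ↔ 0 < v (algebraMap R K f)) :
    (∃ P T : ℕ → R, JumpingPolynomials.IsJumpingSequence v k x y z P T) ∧
      ∀ P T : ℕ → R, JumpingPolynomials.IsJumpingSequence v k x y z P T →
        JumpingPolynomials.IsGeneratingSequence v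
          (JumpingPolynomials.reducedSequence v P T) := by
  have hv : JumpingPolynomials.IsRational k R v :=
    ⟨IsFractionRing.injective R K, hvk, hvres, hvR⟩
  have hx0 : x ≠ 0 := by
    -- otherwise the maximal ideal has two generators, but at least three are needed
    rintro rfl
    have h1 := ringKrullDim_le_spanFinrank_maximalIdeal R
    have h2 : Submodule.spanFinrank (IsLocalRing.maximalIdeal R) ≤ ({y, z} : Set R).ncard := by
      rw [hxyz, Ideal.span, Submodule.span_insert_zero]
      exact Submodule.spanFinrank_span_le_ncard_of_finite (Set.toFinite _)
    have h3 := h2.trans (Set.ncard_insert_le y {z})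
    rw [hdim] at h1
    have h4 : (3 : ℕ) ≤ Submodule.spanFinrank (IsLocalRing.maximalIdeal R) := by exact_mod_cast h1
    rw [Set.ncard_singleton] at h3
    omega
  have hx : 0 < JumpingPolynomials.val v x := by
    have h1 := (hvdom x).1 (hxyz ▸ Ideal.subset_span (by simp))
    rw [JumpingPolynomials.coe_val hv hx0] at h1
    exact_mod_cast h1
  refine ⟨?_, fun P T h => ?_⟩
  · obtain ⟨P, hP0, hP1, hP⟩ := JumpingPolynomials.exists_P (k := k) hv hx y 0
    have hP' : ∀ T : ℕ → R, ∀ i, 0 < i → JumpingPolynomials.PStep v k P T i :=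
      fun T i hi => (hP i hi).congr fun _ _ => rfl
    obtain ⟨T, hT1, hT, hT0⟩ := JumpingPolynomials.exists_T hv (hP0 ▸ hx) hP' z
    exact ⟨P, T, hP0, hP1, hP' T, hT1, hT, hT0⟩
  · refine JumpingPolynomials.isGeneratingSequence_reducedSequence hv (h.P_zero ▸ hx) h.T_succ
      h.P_succ hvdom ?_
    rw [hxyz, h.P_zero, h.P_one, h.T_one]
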